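/- Let $\mathrm{Pol}=\mathbb Z[x_1,x_2,\dots]$. **Slide polynomials.** For a sequence $a=(a_1,\dots,a_k)$ of positive integers let $$\mathfrak F_{a_1,\dots,a_k}=\sum x_{i_1}\cdots x_{i_k},$$ where the sum is over all integer sequences $1\le i_1\le\cdots\le i_k$ with $i_j\le a_j$ for all $j$, and $i_j<i_{j+1}$ whenever $a_j<a_{j+1}$. **Operators.** For $f\in\mathrm{Pol}$ and $i\ge1$ let $$\mathsf R_if=f(x_1,\dots,x_{i-1},0,x_i,x_{i+1},\dots),\qquad \mathsf R_i^\infty f=f(x_1,\dots,x_{i-1},0,0,\dots),$$ $$\partial_if=\frac{f-f(x_1,\dots,x_{i-1},x_{i+1},x_i,x_{i+2},\dots)}{x_i-x_{i+1}},\qquad \mathsf T_i=\mathsf R_i\partial_i,\qquad \mathsf B_i=\sum_{1\le k\le i}x_k\,\mathsf R_k^{\,i-k}\,\mathsf R_{i+1}^\infty .$$ **Schubert polynomials.** Let $S_\infty$ be the group of permutations of $\{1,2,\dots\}$ with finite support, $s_i=(i,i+1)$, and let $\ell(w)$ be the smallest length of a word in the $s_i$ equal to $w$. Let $\mathrm{Red}(w)$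 be the set of sequences $(i_1,\dots,i_k)$ with $k=\ell(w)$ and $w=s_{i_1}\cdots s_{i_k}$. The Schubert polynomials $(\mathfrak S_w)_{w\in S_\infty}$ are the family of homogeneous polynomials in $\mathrm{Pol}$ with $\mathfrak S_{\mathrm{id}}=1$ and, for all $w$ and $i$, $\partial_i\mathfrak S_w=\mathfrak S_{ws_i}$ if $w(i)>w(i+1)$ and $\partial_i\mathfrak S_w=0$ otherwise. **Forest polynomials.** An indexed forest $F$ is a sequence $(T_j)_{j\ge1}$ of rooted plane binary trees (each node has either no child or a left and a right child), all but finitely many of which consist of a single leaf; $\varnothing$ is the forest in which all of them do. Label the leaves of $F$ by $1,2,\dots$ from left to right. Let $c_i(F)$ be the number of internal nodes from which one reaches leaf $i$ by going down left edges, and let $\mathrm{LTer}(F)=\{i : c_i(F)\ne0,\ c_{i+1}(F)=0\}$; these are the $i$ for which $F$ has an internal node whose children are the leaves $i$ and $i+1$. For such $i$, let $F/i$ be the forest obtained by deleting this node, i.e. turning it into a leaf. Let $\mathrm{Trim}(F)$ be the set of sequences $(i_1,\dots,i_k)$ for which $(((F/i_k)/i_{k-1})/\cdots)/i_1$ is defined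 and equal to $\varnothing$. The forest polynomials $(\mathfrak P_F)_F$ are the family of homogeneous polynomials in $\mathrm{Pol}$ with $\mathfrak P_\varnothing=1$ and, for all $F$ and $i$, $\mathsf T_i\mathfrak P_F=\mathfrak P_{F/i}$ if $i\in\mathrm{LTer}(F)$ and $\mathsf T_i\mathfrak P_F=0$ otherwise. **Proposition.** 1. The $\mathsf B_i$ are creation operators for $\partial_i$ and for $\mathsf T_i$: each $\mathsf B_i$ is linear and maps homogeneous polynomials of degree $n$ to homogeneous polynomials of degree $n+1$, and for each $f\in\mathrm{Pol}$ with zero constant term, only finitely many $\partial_if$ and $\mathsf T_if$ are nonzero, and $$\sum_{i\ge1}\mathsf B_i\partial_if=f=\sum_{i\ge1}\mathsf B_i\mathsf T_if.$$ 2. The family of Schubert polynomials exists and is unique, and for every $w\in S_\infty$ the set $\mathrm{Red}(w)$ is finite and $$\mathfrak S_w=\sum_{(i_1,\dots,i_k)\in\mathrm{Red}(w)}\mathfrak F_{i_1,\dots,i_k}.$$ 3. The family of forest polynomials exists and is unique, and for every indexed forest $F$ the set $\mathrm{Trim}(F)$ is finite and $$\mathfrak P_F=\sum_{(i_1,\dots,i_k)\in\mathrm{Trim}(F)}\mathfrak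 F_{i_1,\dots,i_k}.$$ -/

import Mathlib

/-!
Conventions. All index sets `{1, 2, 3, ...}` are replaced by `ℕ = {0, 1, 2, ...}`, by shifting every
index down by one: the variable `X i` is the `(i+1)`-st variable, permutations act on `ℕ`, the
simple transposition `simpleSwap i` exchanges `i` and `i + 1`, leaves of forests are labelled from
`0`, and words are lists of natural numbers.
-/

namespace SlideExpansion

/-- Integer polynomials in countably many variables. -/
abbrev Poly : Type := MvPolynomial ℕ ℤ

/-! ### Operators on polynomials -/

/-- `swapVars i f` exchanges the variables `X i` and `X (i + 1)` in `f`. -/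
noncomputable def swapVars (i : ℕ) : Poly →ₐ[ℤ] Poly :=
  MvPolynomial.rename (Equiv.swap i (i + 1))

theorem sub_dvd_sub_swapVars (i : ℕ) (f : Poly) :
    (MvPolynomial.X i - MvPolynomial.X (i + 1) : Poly) ∣ f - swapVars i f := by
  induction f using MvPolynomial.induction_on with
  | C a => simp [swapVars]
  | add p q hp hq =>
    rw [map_add, add_sub_add_comm]
    exact dvd_add hp hq
  | mul_X p n hp =>
    have hX : (MvPolynomial.X i - MvPolynomial.X (i + 1) : Poly) ∣
        MvPolynomial.X n - swapVars i (MvPolynomial.X n) := by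
      rw [swapVars, MvPolynomial.rename_X]
      by_cases h1 : n = i
      · subst h1
        rw [Equiv.swap_apply_left]
      · by_cases h2 : n = i + 1
        · subst h2
          rw [Equiv.swap_apply_right]
          exact ⟨-1, by ring⟩
        · rw [Equiv.swap_apply_of_ne_of_ne h1 h2, sub_self]
          exact dvd_zero _
    have key : p * MvPolynomial.X n - swapVars i (p * MvPolynomial.X n) =
        (p - swapVars i p) * MvPolynomial.X n +
          swapVars i p * (MvPolynomial.X n - swapVars i (MvPolynomial.X n)) := by
      rw [map_mul]
      ring
    rw [key]
    exact dvd_add (hp.mul_right _) (hX.mul_left _)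

/-- The divided difference: the quotient of `f - swapVars i f` by `X i - X (i + 1)`. -/
noncomputable def divDiff (i : ℕ) (f : Poly) : Poly :=
  (sub_dvd_sub_swapVars i f).choose

theorem divDiff_spec (i : ℕ) (f : Poly) :
    f - swapVars i f = (MvPolynomial.X i - MvPolynomial.X (i + 1)) * divDiff i f :=
  (sub_dvd_sub_swapVars i f).choose_spec

/-- The Bergeron--Sottile map: set the variable at position `i` to zero and shift the later
variables, `f(x₀, …, x_{i-1}, 0, x_i, x_{i+1}, …)`. -/
noncomputable def zeroShift (i : ℕ) : Poly →ₐ[ℤ] Poly :=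
  MvPolynomial.aeval fun j =>
    if j < i then MvPolynomial.X j else if j = i then 0 else MvPolynomial.X (j - 1)

/-- Truncation: set all variables at positions `≥ i` to zero, `f(x₀, …, x_{i-1}, 0, 0, …)`. -/
noncomputable def truncate (i : ℕ) : Poly →ₐ[ℤ] Poly :=
  MvPolynomial.aeval fun j => if j < i then MvPolynomial.X j else 0

/-- The quasisymmetric divided difference. -/
noncomputable def qsymDivDiff (i : ℕ) (f : Poly) : Poly :=
  zeroShift i (divDiff i f)

/-- The slide creator `∑_{k ≤ i} x_k ∘ zeroShift_k^{i-k} ∘ truncate_{i+1}`. -/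
noncomputable def slideCreator (i : ℕ) : Poly →ₗ[ℤ] Poly :=
  ∑ k ∈ Finset.range (i + 1),
    LinearMap.mulLeft ℤ (MvPolynomial.X k : Poly) ∘ₗ
      ((zeroShift k).toLinearMap ^ (i - k)) ∘ₗ (truncate (i + 1)).toLinearMap

/-- `Y` is a family of creation operators for the operators `X`: each `Y i` has degree one, and
`∑_i Y_i X_i f = f` (a finite sum) for all `f` with zero constant term. -/
def IsCreation (Y : ℕ → Poly →ₗ[ℤ] Poly) (X : ℕ → Poly → Poly) : Prop :=
  (∀ (i n : ℕ) (f : Poly), f.IsHomogeneous n → (Y i f).IsHomogeneous (n + 1)) ∧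
  ∀ f : Poly, MvPolynomial.constantCoeff f = 0 →
    {i : ℕ | X i f ≠ 0}.Finite ∧ ∑ᶠ i : ℕ, Y i (X i f) = f

/-- A family `S` of homogeneous polynomials indexed by `M` is dual to the operators `X`:
`S one = 1`, and `X i (S w)` is `S (w / i)` if `i ∈ last w`, and `0` otherwise. Here `quot w i`
is `w / i`, which is only used for `i ∈ last w`. -/
structure IsDual {M : Type} (one : M) (last : M → Set ℕ) (quot : M → ℕ → M)
    (X : ℕ → Poly → Poly) (S : M → Poly) : Prop where
  homogeneous : ∀ w, ∃ d, (S w).IsHomogeneous d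
  map_one : S one = 1
  apply_of_mem : ∀ w i, i ∈ last w → X i (S w) = S (quot w i)
  apply_of_notMem : ∀ w i, i ∉ last w → X i (S w) = 0

/-! ### Slide polynomials -/

open Classical in
/-- Compatible sequences of `a`: weakly increasing sequences `i` of the same length with
`i_j ≤ a_j`, and `i_j < i_{j+1}` whenever `a_j < a_{j+1}`. -/
noncomputable def compatible (a : List ℕ) : Finset (Fin a.length → ℕ) :=
  (Fintype.piFinset fun j : Fin a.length => Finset.Iic (a.get j)).filter fun i =>
    Monotone i ∧
      ∀ j k : Fin a.length, (k : ℕ) = j + 1 → a.get j < a.get k → i j < i k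

/-- The slide polynomial of the sequence `a`. -/
noncomputable def slide (a : List ℕ) : Poly :=
  ∑ i ∈ compatible a, ∏ j, MvPolynomial.X (i j)

/-! ### Permutations and Schubert polynomials -/

/-- The group of permutations of `ℕ` with finite support. -/
def SInf : Subgroup (Equiv.Perm ℕ) where
  carrier := {w | {i | w i ≠ i}.Finite}
  one_mem' := by simp
  mul_mem' := by
    intro u v hu hv
    refine (Set.Finite.union hu hv).subset fun i hi => ?_
    by_contra h
    simp only [Set.mem_union, Set.mem_ofPred_eq, not_or, not_not] at h
    exact hi (by rw [Equiv.Perm.mul_apply, h.2, h.1])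
  inv_mem' := by
    intro u hu
    refine Set.Finite.subset hu fun i hi h => hi ?_
    rw [Equiv.Perm.inv_eq_iff_eq]
    exact h.symm

/-- The simple transposition exchanging `i` and `i + 1`. -/
def simpleSwap (i : ℕ) : SInf :=
  ⟨Equiv.swap i (i + 1), by
    refine (Set.toFinite {i, i + 1}).subset fun j hj => ?_
    by_contra h
    simp only [Set.mem_insert_iff, Set.mem_singleton_iff, not_or] at h
    exact hj (Equiv.swap_apply_of_ne_of_ne h.1 h.2)⟩

/-- The product `s_{i_1} ⋯ s_{i_k}` of a word. -/
def wordProd (l : List ℕ) : SInf := (l.map simpleSwap).prod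

/-- The length of `w`: the smallest length of a word in the simple transpositions equal to `w`. -/
noncomputable def permLength (w : SInf) : ℕ :=
  sInf {n | ∃ l : List ℕ, l.length = n ∧ wordProd l = w}

/-- The set of reduced words of `w`. -/
def Red (w : SInf) : Set (List ℕ) :=
  {l | l.length = permLength w ∧ wordProd l = w}

/-- The descent set of `w`. -/
def descents (w : SInf) : Set ℕ :=
  {i | (w : Equiv.Perm ℕ) (i + 1) < (w : Equiv.Perm ℕ) i}

/-- `S` is the family of Schubert polynomials: the family of homogeneous polynomials dual to the
divided differences, where `w / i = w s_i`. -/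
def IsSchubertFamily (S : SInf → Poly) : Prop :=
  IsDual 1 descents (fun w i => w * simpleSwap i) divDiff S

/-! ### Indexed forests and forest polynomials -/

/-- Rooted plane binary trees: every internal node has a left and a right child, and
`BinaryTree.nil` is the trivial tree, consisting of a single leaf. -/
abbrev PlaneTree : Type := BinaryTree Unit

/-- An indexed forest: a sequence of rooted plane binary trees, all but finitely many trivial. -/
structure IndexedForest where
  tree : ℕ → PlaneTree
  finite_support : {j | tree j ≠ BinaryTree.nil}.Finite

/-- The empty forest: all trees are trivial. -/
def emptyForest : IndexedForest where
  tree := fun _ => BinaryTree.nil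
  finite_support := by simp

/-- With the leaves of the tree numbered from left to right as `0, 1, …`, the number of internal
nodes from which one arrives at leaf `p` by going down left edges. -/
def treeCode : PlaneTree → ℕ → ℕ
  | BinaryTree.nil, _ => 0
  | BinaryTree.node _ l r, p =>
      (if p = 0 then 1 else 0) +
        (if p < l.numLeaves then treeCode l p else treeCode r (p - l.numLeaves))

/-- With the leaves of the tree numbered from left to right as `0, 1, …`, delete the terminal node
whose children are the leaves `p` and `p + 1`, turning it into a leaf (the tree is unchanged if
there is no such node). -/
def treeTrim : PlaneTree → ℕ → PlaneTree
  | BinaryTree.nil, _ => BinaryTree.nil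
  | BinaryTree.node v l r, p =>
      if l = BinaryTree.nil ∧ r = BinaryTree.nil then
        if p = 0 then BinaryTree.nil else BinaryTree.node v l r
      else if p < l.numLeaves then BinaryTree.node v (treeTrim l p) r
      else BinaryTree.node v l (treeTrim r (p - l.numLeaves))

namespace IndexedForest

/-- Leaves of the forest are numbered by `ℕ` from left to right; this is the label of the first
leaf of the tree at position `j`. -/
def firstLeaf (F : IndexedForest) (j : ℕ) : ℕ :=
  ∑ k ∈ Finset.range j, (F.tree k).numLeaves

/-- The code of `F` at `i`: the number of internal nodes of `F` from which one arrives at the leaf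
`i` by going down left edges. The leaf `i` lies in one of the trees at positions `0, …, i`, and
`treeCode` vanishes beyond the leaves of its tree. -/
def code (F : IndexedForest) (i : ℕ) : ℕ :=
  ∑ j ∈ Finset.range (i + 1),
    if F.firstLeaf j ≤ i then treeCode (F.tree j) (i - F.firstLeaf j) else 0

/-- The left terminal set of `F`. -/
def leftTerminal (F : IndexedForest) : Set ℕ :=
  {i | F.code i ≠ 0 ∧ F.code (i + 1) = 0}

/-- The trimmed forest `F / i`: delete the terminal node whose left leaf has label `i`. It is only
used for `i` in the left terminal set of `F`. -/
def trim (F : IndexedForest) (i : ℕ) : IndexedForest where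
  tree := fun j =>
    if F.firstLeaf j ≤ i then treeTrim (F.tree j) (i - F.firstLeaf j) else F.tree j
  finite_support := by
    refine F.finite_support.subset fun j hj h => hj ?_
    simp [h, treeTrim]

end IndexedForest

/-- `IsTrimming l F` for `l = (i_1, …, i_k)`: `(((F / i_k) / i_{k-1}) / ⋯) / i_1` is defined and
equal to the empty forest. -/
inductive IsTrimming : List ℕ → IndexedForest → Prop
  | nil : IsTrimming [] emptyForest
  | snoc (l : List ℕ) (i : ℕ) (F : IndexedForest) (hi : i ∈ F.leftTerminal)
      (hl : IsTrimming l (F.trim i)) : IsTrimming (l ++ [i]) F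

/-- The set of trimming sequences of `F`. -/
def Trim (F : IndexedForest) : Set (List ℕ) := {l | IsTrimming l F}

/-- `P` is the family of forest polynomials: the family of homogeneous polynomials dual to the
quasisymmetric divided differences. -/
def IsForestFamily (P : IndexedForest → Poly) : Prop :=
  IsDual emptyForest IndexedForest.leftTerminal IndexedForest.trim qsymDivDiff P

end SlideExpansion

namespace SlideExpansion

open MvPolynomial

/-! ### Algebra endomorphisms behind the operators -/

/-! Creation. Let `collapse k i` keep the variables below `k`, rename `X i` to `X k` and kill the
rest; then `slideCreator i` is the sum of `X k * collapse k i` over `k ≤ i`. For `D i` either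
divided difference, `X k * collapse k i (D i f)` equals `collapse k i f - collapse k (i + 1) f`
(`collapse_divDiff`, `collapse_qsymDivDiff`). Summing over `i` telescopes for each `k`, and the
remaining truncations telescope to `f` minus its constant term.

Slide expansion. Prescribing the last entry `k` of a compatible sequence for `l ++ [i]` shows that
`slideCreator i` sends `slide l` to `slide (l ++ [i])` (`slideCreator_slide`). For a dual family,
the creation identity writes `S w` as the sum of `slideCreator i (S (quot w i))` over `i ∈ last w`,
so induction on a rank gives the sum over words (`IsDual.expansion`). The expansion also forces
uniqueness; only existence is specific to the two families.

Schubert existence follows Fomin and Stanley. In a nilCoxeter algebra the products `H_m(x) = (1 + x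
u_m)(1 + x u_{m+1}) ⋯` satisfy `H_m(x) H_m(y) = H_m(y) H_m(x)`, by Yang–Baxter. Hence exchanging
`x_i` and `x_{i+1}` in `⋯ H_1(x_1) H_0(x_0)` changes it by `x_i - x_{i+1}` times `u_i` times itself,
so the divided difference acts as `u_i`. Letting `u_i` act through descents of permutations gives
the recursion.

Forest existence uses generating polynomials of labelings of internal nodes. Applying `zeroShift i`
only moves the bounds on the labels, and for `i` and `i + 1` the bounds differ at leaf `i` alone.
The difference counts labelings whose terminal node at leaf `i` has label `i`; removing this node
trims the forest (`treePoly_lowerBound_sub`). -/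

@[simp]
theorem swapVars_X (i j : ℕ) : swapVars i (X j) = X (Equiv.swap i (i + 1) j) := by
  simp [swapVars]

theorem zeroShift_X (i j : ℕ) :
    zeroShift i (X j) = if j < i then X j else if j = i then 0 else X (j - 1) := by
  simp [zeroShift]

theorem truncate_X (i j : ℕ) : truncate i (X j) = if j < i then X j else 0 := by
  simp [truncate]

/-- Keep the variables at positions `< k`, send `X i` to `X k`, and all others to zero:
`f(x₀, …, x_{k-1}, 0, …, 0, x_k, 0, 0, …)` with `x_k` in position `i`. -/
noncomputable def collapse (k i : ℕ) : Poly →ₐ[ℤ] Poly :=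
  aeval fun j => if j < k then X j else if j = i then X k else 0

theorem collapse_X (k i j : ℕ) :
    collapse k i (X j) = if j < k then X j else if j = i then X k else 0 := by
  simp [collapse]

/-- The iterate of `zeroShift`. -/
noncomputable def multiShift (k d : ℕ) : Poly →ₐ[ℤ] Poly :=
  aeval fun j => if j < k then X j else if j < k + d then 0 else X (j - d)

theorem zeroShift_pow (k d : ℕ) :
    (zeroShift k).toLinearMap ^ d = (multiShift k d).toLinearMap := by
  induction d with
  | zero =>
    have : multiShift k 0 = AlgHom.id ℤ Poly := by
      ext1 j
      simp +contextual [multiShift]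
    rw [this]
    rfl
  | succ d ih =>
    have : multiShift k (d + 1) = (zeroShift k).comp (multiShift k d) := by
      ext1 j
      simp only [multiShift, aeval_X, AlgHom.comp_apply]
      by_cases h1 : j < k
      · simp [h1, zeroShift_X]
      · by_cases h2 : j < k + d
        · simp [h1, h2, show j < k + (d + 1) by omega]
        · by_cases h3 : j = k + d
          · simp [h3, zeroShift_X]
          · simp [h1, h2, show ¬ j < k + (d + 1) by omega, zeroShift_X,
              show ¬ j - d < k by omega, show ¬ j - d = k by omega, Nat.sub_sub]
    rw [pow_succ', ih, this]
    rfl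

/-- Truncation kills everything beyond `X i`; the shift then kills positions `k` to `i - 1` and
moves `X i` into position `k`. -/
theorem multiShift_truncate {k i : ℕ} (h : k ≤ i) :
    (multiShift k (i - k)).comp (truncate (i + 1)) = collapse k i := by
  ext1 j
  simp only [AlgHom.comp_apply, truncate_X, collapse_X]
  by_cases h1 : j < k
  · simp [h1, show j < i + 1 by omega, multiShift]
  · by_cases h2 : j = i
    · subst h2
      simp [h1, multiShift, show k + (j - k) = j by omega, show j - (j - k) = k by omega]
    · by_cases h3 : j < i + 1
      · simp [h1, h2, h3, multiShift, show k + (i - k) = i by omega, show j < i by omega]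
      · simp [h1, h2, h3]

theorem slideCreator_apply (i : ℕ) (g : Poly) :
    slideCreator i g = ∑ k ∈ Finset.range (i + 1), X k * collapse k i g := by
  rw [slideCreator, LinearMap.sum_apply]
  refine Finset.sum_congr rfl fun k hk => ?_
  rw [← multiShift_truncate (Nat.lt_succ_iff.1 (Finset.mem_range.1 hk)), zeroShift_pow]
  rfl

theorem isHomogeneous_slideCreator (i n : ℕ) (f : Poly) (hf : f.IsHomogeneous n) :
    (slideCreator i f).IsHomogeneous (n + 1) := by
  rw [slideCreator_apply]
  refine IsHomogeneous.sum _ _ _ fun k _ => ?_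
  rw [add_comm]
  refine (isHomogeneous_X _ _).mul ?_
  rw [← one_mul n]
  refine hf.aeval _ fun j => ?_
  split_ifs
  exacts [isHomogeneous_X _ _, isHomogeneous_X _ _, isHomogeneous_zero _ _ _]

/-- Apply `collapse k i` to the equation defining the quotient: `X i - X (i + 1)` becomes `X k`, and
precomposing with the swap moves the surviving position from `i` to `i + 1`. -/
theorem collapse_divDiff {k i : ℕ} (h : k ≤ i) (f : Poly) :
    X k * collapse k i (divDiff i f) = collapse k i f - collapse k (i + 1) f := by
  have hs : (collapse k i).comp (swapVars i) = collapse k (i + 1) := by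
    ext1 j
    simp only [AlgHom.comp_apply, swapVars_X, collapse_X, Equiv.swap_apply_def]
    grind
  have := congrArg (collapse k i) (divDiff_spec i f)
  rw [map_sub, ← AlgHom.comp_apply, hs, map_mul, map_sub, collapse_X, collapse_X] at this
  simpa [show ¬ i < k by omega, show ¬ i + 1 < k by omega] using this.symm

/-- `zeroShift i` sends `X i - X (i + 1)` to `-X i`, and its composite with the swap is `zeroShift
(i + 1)`. -/
theorem X_mul_qsymDivDiff (i : ℕ) (f : Poly) :
    X i * qsymDivDiff i f = zeroShift (i + 1) f - zeroShift i f := by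
  have hs : (zeroShift i).comp (swapVars i) = zeroShift (i + 1) := by
    ext1 j
    simp only [AlgHom.comp_apply, swapVars_X, zeroShift_X, Equiv.swap_apply_def]
    grind
  have := congrArg (zeroShift i) (divDiff_spec i f)
  rw [map_sub, ← AlgHom.comp_apply, hs, map_mul, map_sub, zeroShift_X, zeroShift_X] at this
  simp only [lt_irrefl, if_false, if_true, show ¬ i + 1 < i by omega, show ¬ i + 1 = i by omega,
    Nat.add_sub_cancel] at this
  rw [qsymDivDiff]
  linear_combination this

theorem collapse_qsymDivDiff {k i : ℕ} (h : k ≤ i) (f : Poly) :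
    X k * collapse k i (qsymDivDiff i f) = collapse k i f - collapse k (i + 1) f := by
  have h1 : (collapse k i).comp (zeroShift (i + 1)) = collapse k i := by
    ext1 j
    simp only [AlgHom.comp_apply, zeroShift_X, apply_ite (collapse k i), map_zero, collapse_X]
    grind
  have h2 : (collapse k i).comp (zeroShift i) = collapse k (i + 1) := by
    ext1 j
    simp only [AlgHom.comp_apply, zeroShift_X, apply_ite (collapse k i), map_zero, collapse_X]
    grind
  have := congrArg (collapse k i) (X_mul_qsymDivDiff i f)
  rw [map_sub, ← AlgHom.comp_apply, ← AlgHom.comp_apply, h1, h2, map_mul, collapse_X] at this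
  simpa [show ¬ i < k by omega] using this

/-! ### The creation property -/

theorem algHom_congr_of_vars_lt {f : Poly} {N : ℕ} (hN : ∀ j ∈ f.vars, j < N)
    {φ ψ : Poly →ₐ[ℤ] Poly} (h : ∀ j < N, φ (X j) = ψ (X j)) : φ f = ψ f :=
  hom_congr_vars (f₁ := (φ : Poly →+* Poly)) (f₂ := (ψ : Poly →+* Poly))
    (RingHom.ext_int _ _) (fun j hj _ => h j (hN j hj)) rfl

theorem exists_vars_lt (f : Poly) : ∃ N, ∀ j ∈ f.vars, j < N :=
  ⟨f.vars.sup id + 1, fun _ hj => Nat.lt_succ_of_le (Finset.le_sup (f := id) hj)⟩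

theorem X_sub_X_ne_zero (i : ℕ) : (X i - X (i + 1) : Poly) ≠ 0 := by
  rw [sub_ne_zero]
  exact fun h => by simpa using X_injective h

/-- The quotient is a mere choice in its definition; cancellation in a domain identifies it. -/
theorem divDiff_eq_of_mul_eq {i : ℕ} {f g : Poly}
    (h : f - swapVars i f = (X i - X (i + 1)) * g) : divDiff i f = g :=
  mul_left_cancel₀ (X_sub_X_ne_zero i) ((divDiff_spec i f).symm.trans h)

theorem qsymDivDiff_eq_of_mul_eq {i : ℕ} {f g : Poly}
    (h : zeroShift (i + 1) f - zeroShift i f = X i * g) : qsymDivDiff i f = g :=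
  mul_left_cancel₀ (X_ne_zero i) ((X_mul_qsymDivDiff i f).trans h)

theorem divDiff_eq_zero_of_vars_lt {f : Poly} {N i : ℕ} (hN : ∀ j ∈ f.vars, j < N) (hi : N ≤ i) :
    divDiff i f = 0 := by
  refine divDiff_eq_of_mul_eq ?_
  rw [mul_zero, sub_eq_zero]
  refine algHom_congr_of_vars_lt (φ := AlgHom.id ℤ Poly) hN fun j hj => ?_
  rw [swapVars_X, Equiv.swap_apply_of_ne_of_ne (by omega) (by omega)]
  rfl

/-- For fixed `k` the sum over `i` telescopes from its first term `collapse k k`, which is `truncate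
(k + 1)`, down to `collapse k n`. -/
theorem sum_slideCreator_of_collapse {D : ℕ → Poly → Poly} {f : Poly}
    (hD : ∀ k i, k ≤ i → X k * collapse k i (D i f) = collapse k i f - collapse k (i + 1) f)
    (n : ℕ) :
    ∑ i ∈ Finset.range n, slideCreator i (D i f) =
      ∑ i ∈ Finset.range n, truncate (i + 1) f - ∑ k ∈ Finset.range n, collapse k n f := by
  induction n with
  | zero => simp
  | succ n ih =>
    have hn : collapse n n = truncate (n + 1) := by
      ext1 j
      rw [collapse_X, truncate_X]
      grind
    rw [Finset.sum_range_succ, ih, slideCreator_apply,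
      Finset.sum_congr rfl fun k hk => hD k n (Nat.lt_succ_iff.1 (Finset.mem_range.1 hk)),
      Finset.sum_sub_distrib, Finset.sum_range_succ (fun k => collapse k n f), hn,
      Finset.sum_range_succ (fun i => truncate (i + 1) f)]
    ring

theorem isCreation_of_collapse {D : ℕ → Poly → Poly}
    (hD : ∀ f k i, k ≤ i → X k * collapse k i (D i f) = collapse k i f - collapse k (i + 1) f)
    (h0 : ∀ f i, divDiff i f = 0 → D i f = 0) : IsCreation slideCreator D := by
  refine ⟨isHomogeneous_slideCreator, fun f hf => ?_⟩
  obtain ⟨N, hN⟩ := exists_vars_lt f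
  have hz : ∀ i, N ≤ i → D i f = 0 := fun i hi => h0 f i (divDiff_eq_zero_of_vars_lt hN hi)
  refine ⟨(Finset.range N).finite_toSet.subset fun i hi => ?_, ?_⟩
  · by_contra h
    exact hi (hz i (by simpa using h))
  rw [finsum_eq_sum_of_support_subset (s := Finset.range N) _ fun i hi => ?_,
    sum_slideCreator_of_collapse (hD f)]
  -- As `f` involves only variables below `N`, the position renamed to `X k` is absent. What is left
  -- is a second telescoping sum, of `truncate (k + 1) f - truncate k f`.
  · have hc : ∀ k ∈ Finset.range N, collapse k N f = truncate k f := fun k _ =>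
      algHom_congr_of_vars_lt hN fun j hj => by
        rw [collapse_X, truncate_X, if_neg hj.ne]
    rw [Finset.sum_congr rfl hc, ← Finset.sum_sub_distrib,
      Finset.sum_range_sub (fun i => truncate i f)]
    have h1 : truncate N f = f :=
      algHom_congr_of_vars_lt (ψ := AlgHom.id ℤ Poly) hN fun j hj => by
        rw [truncate_X, if_pos hj]
        rfl
    have h2 : truncate 0 f = 0 := by
      have : truncate 0 = (Algebra.ofId ℤ Poly).comp (aeval fun _ => (0 : ℤ)) := by
        ext1 j
        simp [truncate_X]
      rw [this, AlgHom.comp_apply, aeval_zero', hf]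
      simp
    rw [h1, h2, sub_zero]
  · by_contra h
    exact hi (by simp only [hz i (by simpa using h), map_zero])

theorem isCreation_divDiff : IsCreation slideCreator divDiff :=
  isCreation_of_collapse (fun f _ _ h => collapse_divDiff h f) fun _ _ h => h

theorem isCreation_qsymDivDiff : IsCreation slideCreator qsymDivDiff :=
  isCreation_of_collapse (fun f _ _ h => collapse_qsymDivDiff h f) fun f i h => by
    rw [qsymDivDiff, h, map_zero]

/-! ### Slide polynomials and slide creators -/

open Classical in
/-- Compatible sequences of a tuple `a`. -/
noncomputable def compatibleTuple {n : ℕ} (a : Fin n → ℕ) : Finset (Fin n → ℕ) :=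
  (Fintype.piFinset fun j => Finset.Iic (a j)).filter fun i =>
    Monotone i ∧ ∀ j k : Fin n, (k : ℕ) = j + 1 → a j < a k → i j < i k

theorem mem_compatibleTuple {n : ℕ} {a c : Fin n → ℕ} :
    c ∈ compatibleTuple a ↔ (∀ j, c j ≤ a j) ∧ Monotone c ∧
      ∀ j k : Fin n, (k : ℕ) = j + 1 → a j < a k → c j < c k := by
  simp [compatibleTuple]

/-- Freeing the length from the list lets `l ++ [i]` be handled as a `Fin.snoc`. -/
theorem slide_eq_sum_compatibleTuple {n : ℕ} (l : List ℕ) (a : Fin n → ℕ)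
    (hn : l.length = n) (ha : ∀ j : Fin n, a j = l.get (j.cast hn.symm)) :
    slide l = ∑ c ∈ compatibleTuple a, ∏ j, X (c j) := by
  subst hn
  obtain rfl : a = l.get := funext ha
  rfl

theorem monotone_snoc_iff {n : ℕ} {c : Fin n → ℕ} {k : ℕ} :
    Monotone (Fin.snoc c k : Fin (n + 1) → ℕ) ↔ Monotone c ∧ ∀ j, c j ≤ k := by
  refine ⟨fun h => ⟨fun i j hij => ?_, fun j => ?_⟩, fun ⟨h1, h2⟩ i j => ?_⟩
  · simpa using h (Fin.castSucc_le_castSucc_iff.2 hij)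
  · simpa using h (Fin.le_last j.castSucc)
  · refine Fin.lastCases (fun _ => ?_) (fun j hij => ?_) j
    · refine Fin.lastCases (by simp) (fun i => by simpa using h2 i) i
    · induction i using Fin.lastCases with
      | last => exact absurd hij (by simp [Fin.le_def])
      | cast i => simpa using h1 (Fin.castSucc_le_castSucc_iff.1 hij)

theorem snoc_mem_compatibleTuple_iff {n : ℕ} {a c : Fin n → ℕ} {i k : ℕ} :
    (Fin.snoc c k : Fin (n + 1) → ℕ) ∈ compatibleTuple (Fin.snoc a i : Fin (n + 1) → ℕ) ↔
      k ≤ i ∧ c ∈ compatibleTuple a ∧ (∀ j, c j ≤ k) ∧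
        ∀ j : Fin n, (j : ℕ) + 1 = n → a j < i → c j < k := by
  rw [mem_compatibleTuple, mem_compatibleTuple, monotone_snoc_iff]
  constructor
  · rintro ⟨h1, ⟨h2, h3⟩, h4⟩
    refine ⟨by simpa using h1 (Fin.last n), ⟨fun j => by simpa using h1 j.castSucc, h2, ?_⟩, h3, ?_⟩
    · intro p q hpq
      simpa using h4 p.castSucc q.castSucc (by simpa using hpq)
    · intro j hj
      simpa using h4 j.castSucc (Fin.last n) (by simp [hj])
  · rintro ⟨h1, ⟨h2, h3, h4⟩, h5, h6⟩
    refine ⟨fun j => ?_, ⟨h3, h5⟩, fun p q => ?_⟩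
    · refine Fin.lastCases (by simpa using h1) (fun j => by simpa using h2 j) j
    · induction q using Fin.lastCases with
      | last =>
        induction p using Fin.lastCases with
        | last => simp
        | cast p => simpa [eq_comm] using h6 p
      | cast q =>
        induction p using Fin.lastCases with
        | last => intro h; have := q.2; simp at h; omega
        | cast p => simpa using h4 p q

/-- The entries equal to the maximal value `k` form a final run. An ascent of `a` would force a
strict increase, so `a` weakly decreases along the run, and its last value is at least `i`. The
induction is on the distance `d` to the end. -/
theorem le_of_compatible_of_eq {n : ℕ} {a c : Fin n → ℕ} {i k : ℕ} (hc : c ∈ compatibleTuple a)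
    (hk : ∀ j, c j ≤ k) (hl : ∀ j : Fin n, (j : ℕ) + 1 = n → a j < i → c j < k) (d : ℕ) :
    ∀ j : Fin n, (j : ℕ) + 1 + d = n → c j = k → i ≤ a j := by
  induction d with
  | zero =>
    intro j hj hjk
    by_contra h
    exact (hl j hj (not_le.1 h)).ne hjk
  | succ d ih =>
    intro j hj hjk
    rw [mem_compatibleTuple] at hc
    have hj' : (j : ℕ) + 1 < n := by omega
    have hm : c j ≤ c ⟨j + 1, hj'⟩ := hc.2.1 (by simp [Fin.le_def])
    have he : c ⟨j + 1, hj'⟩ = k := le_antisymm (hk _) (hjk ▸ hm)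
    have h1 := ih ⟨j + 1, hj'⟩ (by simp; omega) he
    by_contra h
    have := hc.2.2 j ⟨j + 1, hj'⟩ rfl (by omega)
    omega

/-- A monomial survives only if each index is below `k` or equal to `i`. Replacing the indices `i`
by `k` is a bijection onto the sequences that can be extended by `k` when `i` is appended to `a`;
`le_of_compatible_of_eq` ensures that the inverse respects the bounds. -/
theorem collapse_slide {n : ℕ} (a : Fin n → ℕ) {i k : ℕ} (hki : k ≤ i) [DecidablePred
      fun c : Fin n → ℕ => (∀ j, c j ≤ k) ∧ ∀ j : Fin n, (j : ℕ) + 1 = n → a j < i → c j < k] :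
    collapse k i (∑ c ∈ compatibleTuple a, ∏ j, X (c j)) =
      ∑ c ∈ compatibleTuple a with
        (∀ j, c j ≤ k) ∧ ∀ j : Fin n, (j : ℕ) + 1 = n → a j < i → c j < k, ∏ j, X (c j) := by
  classical
  rw [map_sum]
  simp only [map_prod, collapse_X]
  rw [← Finset.sum_filter_of_ne (p := fun c : Fin n → ℕ => ∀ j, c j < k ∨ c j = i)]
  · refine (Finset.sum_bij' (fun c _ j => if c j < k then c j else i)
      (fun c _ j => if c j < k then c j else k) ?_ ?_ ?_ ?_ ?_).symm
    · intro c hc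
      obtain ⟨hc, hk, hl⟩ := Finset.mem_filter.1 hc
      have key : ∀ j, c j = k → i ≤ a j := fun j =>
        le_of_compatible_of_eq hc hk hl (n - 1 - j) j (by omega)
      rw [mem_compatibleTuple] at hc
      rw [Finset.mem_filter, mem_compatibleTuple]
      refine ⟨⟨fun j => ?_, fun p q hpq => ?_, fun p q hpq hlt => ?_⟩, fun j => ?_⟩
      · have := hc.1 j; have := key j; have := hk j; grind
      · have := hc.2.1 hpq; grind
      · have := hc.2.2 p q hpq hlt; have := hk q; grind
      · grind
    · intro c hc
      obtain ⟨hc, hk⟩ := Finset.mem_filter.1 hc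
      rw [mem_compatibleTuple] at hc
      rw [Finset.mem_filter, mem_compatibleTuple]
      refine ⟨⟨fun j => ?_, fun p q hpq => ?_, fun p q hpq hlt => ?_⟩, fun j => ?_, fun j hj hlt => ?_⟩
      · have := hc.1 j; have := hk j; grind
      · have := hc.2.1 hpq; have := hk p; have := hk q; grind
      · have := hc.2.2 p q hpq hlt; have := hk p; have := hk q; grind
      · grind
      -- Here `c j ≤ a j < i` excludes `c j = i`, so the last entry is already below `k`.
      · have := hc.1 j; have := hk j; grind
    · intro c hc
      have := (Finset.mem_filter.1 hc).2.1
      funext j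
      have := this j
      grind
    · intro c hc
      have := (Finset.mem_filter.1 hc).2
      funext j
      have := this j
      grind
    · intro c hc
      have := (Finset.mem_filter.1 hc).2.1
      refine Finset.prod_congr rfl fun j _ => ?_
      have := this j
      by_cases h : c j < k
      · simp [h]
      · simp [show ¬ i < k by omega, show c j = k by omega]
  · intro c _ hne j
    have := Finset.prod_ne_zero_iff.1 hne j (Finset.mem_univ j)
    by_contra h
    rw [not_or] at h
    simp [h.1, h.2] at this

theorem slideCreator_slide (i : ℕ) (l : List ℕ) : slideCreator i (slide l) = slide (l ++ [i]) := by
  classical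
  have h1 := slide_eq_sum_compatibleTuple l l.get rfl fun _ => rfl
  have h2 := slide_eq_sum_compatibleTuple (l ++ [i]) (Fin.snoc l.get i : Fin (l.length + 1) → ℕ)
    (by simp) fun j => by
      refine Fin.lastCases ?_ (fun j => ?_) j <;> simp
  rw [slideCreator_apply, h1, h2, Finset.sum_congr rfl fun k hk => by
    rw [collapse_slide l.get (Nat.lt_succ_iff.1 (Finset.mem_range.1 hk)), Finset.mul_sum],
    Finset.sum_sigma']
  refine Finset.sum_bij' (fun p _ => (Fin.snoc p.2 p.1 : Fin (l.length + 1) → ℕ))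
    (fun c _ => ⟨c (Fin.last _), Fin.init c⟩) ?_ ?_ ?_ ?_ ?_
  · rintro ⟨k, c⟩ h
    simp only [Finset.mem_sigma, Finset.mem_range, Finset.mem_filter] at h
    exact snoc_mem_compatibleTuple_iff.2 ⟨Nat.lt_succ_iff.1 h.1, h.2.1, h.2.2⟩
  · intro c h
    rw [← Fin.snoc_init_self c, snoc_mem_compatibleTuple_iff] at h
    simp only [Finset.mem_sigma, Finset.mem_range, Finset.mem_filter]
    exact ⟨by omega, h.2.1, h.2.2⟩
  · rintro ⟨k, c⟩ h
    simp
  · intro c h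
    simp
  · rintro ⟨k, c⟩ h
    simp [Fin.prod_univ_castSucc, mul_comm]

theorem slide_nil : slide [] = 1 := by
  rw [slide_eq_sum_compatibleTuple (n := 0) [] Fin.elim0 rfl fun j => j.elim0]
  have : compatibleTuple (Fin.elim0 : Fin 0 → ℕ) = {Fin.elim0} := by
    ext c
    simp [mem_compatibleTuple, Subsingleton.elim c Fin.elim0, Subsingleton.monotone]
  simp [this]

/-! ### Dual families and their slide expansions -/

theorem divDiff_eq_zero_of_isHomogeneous_zero (i : ℕ) {f : Poly} (hf : f.IsHomogeneous 0) :
    divDiff i f = 0 := by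
  rw [← totalDegree_zero_iff_isHomogeneous, totalDegree_eq_zero_iff_eq_C] at hf
  refine divDiff_eq_zero_of_vars_lt (N := 0) (fun j hj => ?_) (Nat.zero_le i)
  rw [hf, vars_C] at hj
  simp at hj

theorem qsymDivDiff_eq_zero_of_isHomogeneous_zero (i : ℕ) {f : Poly} (hf : f.IsHomogeneous 0) :
    qsymDivDiff i f = 0 := by
  rw [qsymDivDiff, divDiff_eq_zero_of_isHomogeneous_zero i hf, map_zero]

section Dual

variable {M : Type} {one : M} {last : M → Set ℕ} {quot : M → ℕ → M} {X : ℕ → Poly → Poly}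
  {S : M → Poly}

/-- Operators with `X i 0 = 0` lead from `S w` to `S one = 1`, so `S w` cannot vanish. -/
theorem IsDual.ne_zero (hS : IsDual one last quot X S) (hconst : ∀ i, X i 0 = 0) {rank : M → ℕ}
    (hrank : ∀ w, ∀ i ∈ last w, rank (quot w i) < rank w)
    (hlast : ∀ w, w ≠ one → (last w).Nonempty) (w : M) : S w ≠ 0 := by
  induction h : rank w using Nat.strong_induction_on generalizing w with
  | _ n ih =>
    by_cases hw : w = one
    · rw [hw, hS.map_one]
      exact one_ne_zero
    · obtain ⟨i, hi⟩ := hlast w hw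
      intro h0
      refine ih _ (h ▸ hrank w i hi) (quot w i) rfl ?_
      rw [← hS.apply_of_mem w i hi, h0, hconst]

theorem IsDual.expansion (hS : IsDual one last quot X S) (hX : IsCreation slideCreator X)
    (hconst : ∀ i (f : Poly), f.IsHomogeneous 0 → X i f = 0) {rank : M → ℕ}
    (hrank : ∀ w, ∀ i ∈ last w, rank (quot w i) < rank w)
    (hlast : ∀ w, w ≠ one → (last w).Nonempty) {W : M → Set (List ℕ)} (hone : W one = {[]})
    (hW : ∀ w, w ≠ one → W w = ⋃ i ∈ last w, (· ++ [i]) '' W (quot w i)) (w : M) :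
    (W w).Finite ∧ S w = ∑ᶠ a ∈ W w, slide a := by
  induction h : rank w using Nat.strong_induction_on generalizing w with
  | _ n ih =>
    by_cases hw : w = one
    · rw [hw, hone, hS.map_one]
      simp [slide_nil]
    have ih' : ∀ i ∈ last w, (W (quot w i)).Finite ∧
        S (quot w i) = ∑ᶠ a ∈ W (quot w i), slide a :=
      fun i hi => ih _ (h ▸ hrank w i hi) _ rfl
    have hne : ∀ u, S u ≠ 0 := hS.ne_zero (fun i => hconst i 0 (isHomogeneous_zero _ _ _)) hrank hlast
    have happly : ∀ i ∈ last w, X i (S w) ≠ 0 := fun i hi => by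
      rw [hS.apply_of_mem w i hi]
      exact hne _
    -- In degree zero every `X i` would kill `S w`, contradicting `happly`.
    have hcoeff : constantCoeff (S w) = 0 := by
      obtain ⟨d, hd⟩ := hS.homogeneous w
      obtain ⟨i, hi⟩ := hlast w hw
      rcases Nat.eq_zero_or_pos d with rfl | hpos
      · exact absurd (hconst i _ hd) (happly i hi)
      · rw [constantCoeff_eq]
        exact hd.coeff_eq_zero (by simpa using hpos.ne)
    obtain ⟨hfin, hsum⟩ := hX.2 (S w) hcoeff
    -- Finiteness of `last w` is not assumed: it comes from the creation property and the
    -- nonvanishing of `S`.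
    have hlf : (last w).Finite := hfin.subset happly
    have hfin' : ∀ i ∈ last w, ((· ++ [i]) '' W (quot w i)).Finite :=
      fun i hi => (ih' i hi).1.image _
    rw [hW w hw]
    refine ⟨hlf.biUnion hfin', ?_⟩
    rw [finsum_mem_biUnion ?_ hlf hfin', ← hsum, finsum_mem_def]
    · refine finsum_congr fun i => ?_
      by_cases hi : i ∈ last w
      · rw [Set.indicator_of_mem hi, hS.apply_of_mem w i hi, (ih' i hi).2,
          finsum_mem_image fun a _ b _ hab => List.append_cancel_right hab]
        rw [← LinearMap.toAddMonoidHom_coe, AddMonoidHom.map_finsum_mem _ _ (ih' i hi).1]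
        exact finsum_mem_congr rfl fun a _ => slideCreator_slide i a
      · rw [Set.indicator_of_notMem hi, hS.apply_of_notMem w i hi, map_zero]
    · intro i _ j _ hij
      refine Set.disjoint_left.2 ?_
      rintro _ ⟨a, _, rfl⟩ ⟨b, _, hb⟩
      exact hij (by simpa using (List.append_inj' hb rfl).2.symm)

end Dual

/-! ### Descents, inversions and reduced words -/

theorem coe_mul_simpleSwap (w : SInf) (i j : ℕ) :
    ((w * simpleSwap i : SInf) : Equiv.Perm ℕ) j = (w : Equiv.Perm ℕ) (Equiv.swap i (i + 1) j) :=
  rfl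

theorem mem_descents {w : SInf} {i : ℕ} :
    i ∈ descents w ↔ (w : Equiv.Perm ℕ) (i + 1) < (w : Equiv.Perm ℕ) i :=
  Iff.rfl

theorem simpleSwap_mul_self (i : ℕ) : simpleSwap i * simpleSwap i = 1 :=
  Subtype.ext (Equiv.swap_mul_self i (i + 1))

@[simp]
theorem mul_simpleSwap_mul_simpleSwap (w : SInf) (i : ℕ) :
    w * simpleSwap i * simpleSwap i = w := by
  rw [mul_assoc, simpleSwap_mul_self, mul_one]

theorem mem_descents_mul_simpleSwap {w : SInf} {i : ℕ} :
    i ∈ descents (w * simpleSwap i) ↔ i ∉ descents w := by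
  simp only [mem_descents, coe_mul_simpleSwap, Equiv.swap_apply_left, Equiv.swap_apply_right]
  have : (w : Equiv.Perm ℕ) i ≠ (w : Equiv.Perm ℕ) (i + 1) := by simp
  omega

theorem exists_fixes_ge (w : SInf) : ∃ N, ∀ j, N ≤ j → (w : Equiv.Perm ℕ) j = j := by
  obtain ⟨N, hN⟩ := w.2.bddAbove
  refine ⟨N + 1, fun j hj => ?_⟩
  by_contra h
  have : j ≤ N := hN h
  omega

/-- Without descents, `w` and its inverse are both strictly increasing on `ℕ`, so neither moves a
point down. -/
theorem descents_nonempty {w : SInf} (hw : w ≠ 1) : (descents w).Nonempty := by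
  by_contra h
  rw [Set.not_nonempty_iff_eq_empty] at h
  have hmono : StrictMono (w : Equiv.Perm ℕ) := strictMono_nat_of_lt_succ fun i => by
    have h1 : ¬ (w : Equiv.Perm ℕ) (i + 1) < (w : Equiv.Perm ℕ) i := fun hi => by
      have : i ∈ descents w := hi
      simp [h] at this
    have h2 : (w : Equiv.Perm ℕ) i ≠ (w : Equiv.Perm ℕ) (i + 1) := by simp
    omega
  refine hw (Subtype.ext (Equiv.ext fun j => ?_))
  have h1 : j ≤ (w : Equiv.Perm ℕ) j := hmono.le_apply
  by_contra hne
  have hlt : j < (w : Equiv.Perm ℕ) j := lt_of_le_of_ne h1 (Ne.symm hne)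
  have hinv : StrictMono ((w : Equiv.Perm ℕ)⁻¹ : Equiv.Perm ℕ) := fun a b hab => by
    rw [← hmono.lt_iff_lt]
    simpa using hab
  have := hinv.le_apply (x := (w : Equiv.Perm ℕ) j)
  simp at this
  omega

/-- The inversions of a permutation. -/
def inversions (w : SInf) : Set (ℕ × ℕ) :=
  {p | p.1 < p.2 ∧ (w : Equiv.Perm ℕ) p.2 < (w : Equiv.Perm ℕ) p.1}

theorem finite_inversions (w : SInf) : (inversions w).Finite := by
  obtain ⟨N, hN⟩ := exists_fixes_ge w
  refine ((Set.finite_Iio N).prod (Set.finite_Iio N)).subset ?_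
  rintro ⟨a, b⟩ ⟨h1, h2⟩
  simp only at h1 h2
  have hb : b < N := by
    by_contra hb
    rw [hN b (by omega)] at h2
    have := (w : Equiv.Perm ℕ).injective (hN _ (show N ≤ (w : Equiv.Perm ℕ) a by omega))
    omega
  exact ⟨show a < N by omega, hb⟩

/-- The number of inversions of a permutation. -/
noncomputable def inversionNumber (w : SInf) : ℕ := (inversions w).ncard

theorem inversionNumber_one : inversionNumber 1 = 0 := by
  rw [inversionNumber, Set.ncard_eq_zero (finite_inversions 1)]
  ext p
  simp only [inversions, Set.mem_ofPred_eq, OneMemClass.coe_one, Equiv.Perm.one_apply,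
    Set.mem_empty_iff_false, iff_false]
  omega

theorem swap_succ_lt_swap_succ {i a b : ℕ} (h : a < b) (hne : (a, b) ≠ (i, i + 1)) :
    Equiv.swap i (i + 1) a < Equiv.swap i (i + 1) b := by
  simp only [ne_eq, Prod.mk.injEq] at hne
  simp only [Equiv.swap_apply_def]
  grind

/-- Applying the swap to both coordinates preserves the order of every pair except `(i, i + 1)`, so
it matches the inversions of the product with those of `w` other than that pair. -/
theorem inversionNumber_mul_simpleSwap_of_mem {w : SInf} {i : ℕ} (hi : i ∈ descents w) :
    inversionNumber (w * simpleSwap i) + 1 = inversionNumber w := by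
  have hmem : (i, i + 1) ∈ inversions w := ⟨Nat.lt_succ_self i, hi⟩
  rw [inversionNumber, inversionNumber,
    ← Set.ncard_sdiff_singleton_add_one hmem (finite_inversions w)]
  congr 1
  have hinj : Function.Injective
      (Prod.map (Equiv.swap i (i + 1)) (Equiv.swap i (i + 1))) :=
    (Equiv.injective _).prodMap (Equiv.injective _)
  rw [← Set.ncard_image_of_injective (inversions w \ {(i, i + 1)}) hinj]
  congr 1
  ext ⟨a, b⟩
  constructor
  · rintro ⟨h1, h2⟩
    simp only [coe_mul_simpleSwap] at h2
    have hne : (a, b) ≠ (i, i + 1) := by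
      rintro h
      obtain ⟨rfl, rfl⟩ := Prod.mk.injEq .. ▸ h
      rw [Equiv.swap_apply_left, Equiv.swap_apply_right] at h2
      exact lt_asymm h2 hi
    refine ⟨(Equiv.swap i (i + 1) a, Equiv.swap i (i + 1) b),
      ⟨⟨swap_succ_lt_swap_succ h1 hne, h2⟩, fun h => ?_⟩, by simp⟩
    simp only [Set.mem_singleton_iff, Prod.mk.injEq] at h
    have h3 : a = i + 1 := by simpa using congrArg (Equiv.swap i (i + 1)) h.1
    have h4 : b = i := by simpa using congrArg (Equiv.swap i (i + 1)) h.2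
    omega
  · rintro ⟨⟨c, d⟩, ⟨⟨h1, h2⟩, hne⟩, h⟩
    simp only [Prod.map_apply, Prod.mk.injEq] at h
    obtain ⟨rfl, rfl⟩ := h
    refine ⟨swap_succ_lt_swap_succ h1 hne, ?_⟩
    change (w : Equiv.Perm ℕ) (Equiv.swap i (i + 1) (Equiv.swap i (i + 1) d)) <
      (w : Equiv.Perm ℕ) (Equiv.swap i (i + 1) (Equiv.swap i (i + 1) c))
    simpa using h2

theorem inversionNumber_mul_simpleSwap_of_notMem {w : SInf} {i : ℕ} (hi : i ∉ descents w) :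
    inversionNumber (w * simpleSwap i) = inversionNumber w + 1 := by
  rw [← inversionNumber_mul_simpleSwap_of_mem (mem_descents_mul_simpleSwap.2 hi),
    mul_simpleSwap_mul_simpleSwap]

theorem wordProd_append_singleton (l : List ℕ) (i : ℕ) :
    wordProd (l ++ [i]) = wordProd l * simpleSwap i := by
  simp [wordProd]

theorem inversionNumber_wordProd_le (l : List ℕ) : inversionNumber (wordProd l) ≤ l.length := by
  induction l using List.reverseRecOn with
  | nil => simp [wordProd, inversionNumber_one]
  | append_singleton l i ih =>
    rw [wordProd_append_singleton, List.length_append, List.length_singleton]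
    by_cases h : i ∈ descents (wordProd l)
    · have := inversionNumber_mul_simpleSwap_of_mem h
      omega
    · have := inversionNumber_mul_simpleSwap_of_notMem h
      omega

theorem exists_wordProd_eq (w : SInf) :
    ∃ l : List ℕ, l.length = inversionNumber w ∧ wordProd l = w := by
  induction h : inversionNumber w using Nat.strong_induction_on generalizing w with
  | _ n ih =>
    by_cases hw : w = 1
    · subst hw
      exact ⟨[], by simpa [inversionNumber_one] using h, rfl⟩
    · obtain ⟨i, hi⟩ := descents_nonempty hw
      have h1 := inversionNumber_mul_simpleSwap_of_mem hi
      obtain ⟨l, hl, hl'⟩ := ih _ (by omega) (w * simpleSwap i) rfl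
      exact ⟨l ++ [i], by simp; omega, by simp [wordProd_append_singleton, hl']⟩

theorem permLength_eq_inversionNumber (w : SInf) : permLength w = inversionNumber w := by
  refine le_antisymm (Nat.sInf_le (exists_wordProd_eq w)) ?_
  refine le_csInf ⟨_, exists_wordProd_eq w⟩ ?_
  rintro n ⟨l, rfl, rfl⟩
  exact inversionNumber_wordProd_le l

theorem Red_one : Red 1 = {[]} := by
  ext l
  simp only [Red, permLength_eq_inversionNumber, inversionNumber_one, Set.mem_ofPred_eq,
    List.length_eq_zero_iff, Set.mem_singleton_iff, and_iff_left_iff_imp]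
  rintro rfl
  rfl

/-- The last letter of a reduced word is a descent: otherwise the word without it would be shorter
than the inversion number of its product. -/
theorem Red_eq_biUnion {w : SInf} (hw : w ≠ 1) :
    Red w = ⋃ i ∈ descents w, (· ++ [i]) '' Red (w * simpleSwap i) := by
  ext l
  simp only [Red, permLength_eq_inversionNumber, Set.mem_ofPred_eq, Set.mem_iUnion, Set.mem_image,
    exists_prop]
  constructor
  · rintro ⟨h1, h2⟩
    induction l using List.reverseRecOn with
    | nil => exact absurd h2.symm hw
    | append_singleton l i _ =>
      rw [wordProd_append_singleton] at h2
      rw [List.length_append, List.length_singleton] at h1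
      have h3 : wordProd l = w * simpleSwap i := by rw [← h2, mul_simpleSwap_mul_simpleSwap]
      have h4 := inversionNumber_wordProd_le l
      rw [h3] at h4
      have h5 : i ∈ descents w := by
        by_contra hi
        have := inversionNumber_mul_simpleSwap_of_notMem hi
        omega
      have := inversionNumber_mul_simpleSwap_of_mem h5
      exact ⟨i, h5, l, ⟨by omega, h3⟩, rfl⟩
  · rintro ⟨i, hi, l, ⟨h1, h2⟩, rfl⟩
    have := inversionNumber_mul_simpleSwap_of_mem hi
    refine ⟨by simp; omega, ?_⟩
    rw [wordProd_append_singleton, h2, mul_simpleSwap_mul_simpleSwap]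

/-! ### Commuting products in nilCoxeter algebras -/

section NilCoxeter

variable {A E : Type*} [CommRing A] [Ring E] [Algebra A E]

/-- The relations of the nilCoxeter algebra of the infinite symmetric group. -/
structure IsNilCoxeter (u : ℕ → E) : Prop where
  sq : ∀ i, u i * u i = 0
  comm : ∀ i j, i + 2 ≤ j → u i * u j = u j * u i
  braid : ∀ i, u i * u (i + 1) * u i = u (i + 1) * u i * u (i + 1)

/-- The product `(1 + x u_m) (1 + x u_{m+1}) ⋯ (1 + x u_{m+n-1})`. -/
def expProd (u : ℕ → E) (x : A) : ℕ → ℕ → E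
  | _, 0 => 1
  | m, n + 1 => (1 + x • u m) * expProd u x (m + 1) n

variable {u : ℕ → E}

theorem commute_expProd_of_commute {e : E} (x : A) (n : ℕ) :
    ∀ m, (∀ j, m ≤ j → Commute e (u j)) → Commute e (expProd u x m n) := by
  induction n with
  | zero => exact fun _ _ => Commute.one_right _
  | succ n ih =>
    intro m h
    exact ((Commute.one_right _).add_right ((h m le_rfl).smul_right x)).mul_right
      (ih (m + 1) fun j hj => h j (by omega))

theorem IsNilCoxeter.commute_expProd (hu : IsNilCoxeter u) (i : ℕ) (x : A) {m n : ℕ}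
    (h : i + 2 ≤ m) : Commute (u i) (expProd u x m n) :=
  commute_expProd_of_commute x n m fun j hj => hu.comm i j (h.trans hj)

theorem IsNilCoxeter.one_add_mul_one_add (hu : IsNilCoxeter u) (i : ℕ) (x y : A) :
    (1 + x • u i) * (1 + y • u i) = 1 + (x + y) • u i := by
  simp only [mul_add, add_mul, mul_one, one_mul, smul_mul_assoc, mul_smul_comm, hu.sq, smul_zero,
    add_smul]
  module

theorem IsNilCoxeter.yang_baxter (hu : IsNilCoxeter u) (i : ℕ) (s t : A) :
    (1 + s • u i) * (1 + (s + t) • u (i + 1)) * (1 + t • u i) =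
      (1 + t • u (i + 1)) * (1 + (s + t) • u i) * (1 + s • u (i + 1)) := by
  have h1 := hu.braid i
  simp only [mul_add, add_mul, mul_one, one_mul, smul_mul_assoc, mul_smul_comm, hu.sq, smul_zero,
    add_smul, smul_add, h1]
  simp only [← mul_assoc, smul_smul, mul_comm t s, mul_comm t (s * s)]
  module

/-- Induction on the number of factors: move `1 + x u_m` left past the tail of the other product,
rearrange the three leading factors by Yang–Baxter, and use commutation of the products starting at
`m + 1`. -/
theorem IsNilCoxeter.commute_expProd_expProd (hu : IsNilCoxeter u) (x y : A) (n : ℕ) :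
    ∀ m, Commute (expProd u x m n) (expProd u y m n) := by
  induction n using Nat.strong_induction_on with
  | _ n ih =>
    intro m
    match n with
    | 0 => exact Commute.one_right _
    | 1 =>
      simp only [expProd, mul_one]
      rw [Commute, SemiconjBy, hu.one_add_mul_one_add, hu.one_add_mul_one_add, add_comm x]
    | n + 2 =>
      have hc : ∀ z w : A, Commute (1 + z • u m) (expProd u w (m + 1 + 1) n) := fun z w =>
        (Commute.one_left _).add_left ((hu.commute_expProd m w le_rfl).smul_left z)
      -- Split `1 + y u_m` as `(1 + x u_m)(1 + (y - x) u_m)` and apply Yang–Baxter with parameters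
      -- `y - x` and `x`. The resulting factor with parameter `y - x` is split again, so that its
      -- part `-x` cancels later.
      have hbr : (1 + y • u m) * (1 + y • u (m + 1)) * (1 + x • u m) =
          (1 + x • u m) * (1 + x • u (m + 1)) * (1 + y • u m) *
            ((1 + (-x) • u (m + 1)) * (1 + y • u (m + 1))) := by
        have h1 := hu.yang_baxter m (y - x) x
        have h2 := hu.one_add_mul_one_add m x (y - x)
        have h3 := hu.one_add_mul_one_add (m + 1) (-x) y
        rw [sub_add_cancel] at h1
        rw [add_sub_cancel] at h2
        calc (1 + y • u m) * (1 + y • u (m + 1)) * (1 + x • u m)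
            = (1 + x • u m) * ((1 + (y - x) • u m) * (1 + y • u (m + 1)) * (1 + x • u m)) := by
              rw [← h2]
              simp only [mul_assoc]
          _ = (1 + x • u m) * ((1 + x • u (m + 1)) * (1 + y • u m) *
                (1 + (y - x) • u (m + 1))) := by
              rw [h1]
          _ = _ := by
              rw [h3, neg_add_eq_sub]
              simp only [mul_assoc]
      have hcancel : (1 + (-x) • u (m + 1)) * (1 + x • u (m + 1)) = 1 := by
        rw [hu.one_add_mul_one_add, neg_add_cancel, zero_smul, add_zero]
      have key : expProd u y m (n + 2) * expProd u x m (n + 2) =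
          expProd u x m (n + 2) * expProd u y m (n + 2) := by
        have ih1 := (ih (n + 1) (by omega) (m + 1)).eq
        calc expProd u y m (n + 2) * expProd u x m (n + 2)
            = (1 + y • u m) * (1 + y • u (m + 1)) *
                (expProd u y (m + 1 + 1) n * (1 + x • u m)) * expProd u x (m + 1) (n + 1) := by
              simp only [expProd, mul_assoc]
          _ = (1 + y • u m) * (1 + y • u (m + 1)) * (1 + x • u m) * expProd u y (m + 1 + 1) n *
                expProd u x (m + 1) (n + 1) := by
              rw [← (hc x y).eq]
              simp only [mul_assoc]
          _ = (1 + x • u m) * (1 + x • u (m + 1)) * (1 + y • u m) * (1 + (-x) • u (m + 1)) *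
                (expProd u y (m + 1) (n + 1) * expProd u x (m + 1) (n + 1)) := by
              rw [hbr]
              simp only [expProd, mul_assoc]
          _ = (1 + x • u m) * (1 + x • u (m + 1)) * (1 + y • u m) *
                ((1 + (-x) • u (m + 1)) * (1 + x • u (m + 1))) *
                expProd u x (m + 1 + 1) n * expProd u y (m + 1) (n + 1) := by
              rw [← ih1]
              simp only [expProd, mul_assoc]
          _ = (1 + x • u m) * (1 + x • u (m + 1)) * ((1 + y • u m) *
                expProd u x (m + 1 + 1) n) * expProd u y (m + 1) (n + 1) := by
              rw [hcancel]
              simp only [mul_one, mul_assoc]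
          _ = expProd u x m (n + 2) * expProd u y m (n + 2) := by
              rw [(hc y x).eq]
              simp only [expProd, mul_assoc]
      exact key.symm

/-- Since `H_{m+1}(z) = (1 - z u_m) H_m(z)` and `H_m(x)`, `H_m(y)` commute, both products on the
left are multiples of `H_m(y) H_m(x)`, with difference `(x - y) u_m`. Finally `u_m (1 - y u_m) =
u_m` restores `H_{m+1}(y)`. -/
theorem IsNilCoxeter.expProd_mul_sub (hu : IsNilCoxeter u) (x y : A) (m n : ℕ) :
    expProd u y (m + 1) n * expProd u x m (n + 1) - expProd u x (m + 1) n * expProd u y m (n + 1) =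
      (x - y) • (u m * (expProd u y (m + 1) n * expProd u x m (n + 1))) := by
  have h1 : ∀ z : A, expProd u z (m + 1) n = (1 + (-z) • u m) * expProd u z m (n + 1) := fun z => by
    rw [expProd, ← mul_assoc, hu.one_add_mul_one_add, neg_add_cancel, zero_smul, add_zero, one_mul]
  have h2 : ∀ z : A, u m * (1 + z • u m) = u m := fun z => by
    rw [mul_add, mul_one, mul_smul_comm, hu.sq, smul_zero, add_zero]
  rw [h1 x, h1 y, mul_assoc, mul_assoc, (hu.commute_expProd_expProd x y (n + 1) m).eq, ← sub_mul,
    ← mul_assoc (u m), h2, ← smul_mul_assoc]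
  congr 1
  module

/-- The partial products of `⋯ H_2(y_2) H_1(y_1) H_0(y_0)`, where
`H_m(x) = (1 + x u_m) ⋯ (1 + x u_{N-1})`. -/
def schubertProd (u : ℕ → E) (y : ℕ → A) (N : ℕ) : ℕ → E
  | 0 => 1
  | k + 1 => expProd u (y k) k (N - k) * schubertProd u y N k

theorem schubertProd_congr {y z : ℕ → A} (N k : ℕ) (h : ∀ j < k, y j = z j) :
    schubertProd u y N k = schubertProd u z N k := by
  induction k with
  | zero => rfl
  | succ k ih => rw [schubertProd, schubertProd, h k (by omega), ih fun j hj => h j (by omega)]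

/-- Only the adjacent factors `H_{i+1} H_i` see the swap. Every factor to their left involves
generators of index at least `i + 2`, which commute with `u_i`. -/
theorem IsNilCoxeter.schubertProd_sub (hu : IsNilCoxeter u) (y : ℕ → A) {N i : ℕ} (hi : i + 2 ≤ N)
    (k : ℕ) (hk : i + 2 ≤ k) :
    schubertProd u y N k - schubertProd u (y ∘ Equiv.swap i (i + 1)) N k =
      (y i - y (i + 1)) • (u i * schubertProd u y N k) := by
  induction k, hk using Nat.le_induction with
  | base =>
    have hc : schubertProd u (y ∘ Equiv.swap i (i + 1)) N i = schubertProd u y N i :=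
      schubertProd_congr N i fun j hj => by
        rw [Function.comp_apply, Equiv.swap_apply_of_ne_of_ne (by omega) (by omega)]
    obtain ⟨n, rfl⟩ := Nat.exists_eq_add_of_le hi
    simp only [schubertProd, hc, Function.comp_apply, Equiv.swap_apply_left,
      Equiv.swap_apply_right, ← mul_assoc]
    rw [show i + 2 + n - i = n + 1 + 1 by omega, show i + 2 + n - (i + 1) = n + 1 by omega,
      ← sub_mul, hu.expProd_mul_sub, smul_mul_assoc, ← mul_assoc]
  | succ k hk ih =>
    have hyk : (y ∘ Equiv.swap i (i + 1)) k = y k := by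
      rw [Function.comp_apply, Equiv.swap_apply_of_ne_of_ne (by omega) (by omega)]
    rw [schubertProd, schubertProd, hyk, ← mul_sub, ih, mul_smul_comm, ← mul_assoc, ← mul_assoc,
      (hu.commute_expProd i (y k) hk).eq]

end NilCoxeter

/-! ### Existence of Schubert polynomials -/

open Classical in
/-- The nilCoxeter generator acting on families of polynomials indexed by permutations. -/
noncomputable def descentOp (i : ℕ) : Module.End Poly (SInf → Poly) where
  toFun Φ w := if i ∈ descents w then Φ (w * simpleSwap i) else 0
  map_add' Φ Ψ := by
    funext w
    by_cases h : i ∈ descents w <;> simp [h]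
  map_smul' c Φ := by
    funext w
    by_cases h : i ∈ descents w <;> simp [h]

theorem descentOp_apply_of_mem {i : ℕ} {w : SInf} (h : i ∈ descents w) (Φ : SInf → Poly) :
    descentOp i Φ w = Φ (w * simpleSwap i) :=
  if_pos h

theorem descentOp_apply_of_notMem {i : ℕ} {w : SInf} (h : i ∉ descents w) (Φ : SInf → Poly) :
    descentOp i Φ w = 0 :=
  if_neg h

theorem simpleSwap_comm {i j : ℕ} (h : i + 2 ≤ j) :
    simpleSwap i * simpleSwap j = simpleSwap j * simpleSwap i := by
  refine Subtype.ext (Equiv.ext fun k => ?_)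
  change Equiv.swap i (i + 1) (Equiv.swap j (j + 1) k) =
    Equiv.swap j (j + 1) (Equiv.swap i (i + 1) k)
  simp only [Equiv.swap_apply_def]
  grind

theorem simpleSwap_braid (i : ℕ) :
    simpleSwap i * simpleSwap (i + 1) * simpleSwap i =
      simpleSwap (i + 1) * simpleSwap i * simpleSwap (i + 1) := by
  refine Subtype.ext (Equiv.ext fun k => ?_)
  change Equiv.swap i (i + 1) (Equiv.swap (i + 1) (i + 1 + 1) (Equiv.swap i (i + 1) k)) =
    Equiv.swap (i + 1) (i + 1 + 1) (Equiv.swap i (i + 1) (Equiv.swap (i + 1) (i + 1 + 1) k))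
  simp only [Equiv.swap_apply_def]
  grind

theorem mem_descents_mul_of_add_two_le {i j : ℕ} (h : i + 2 ≤ j ∨ j + 2 ≤ i) (w : SInf) :
    j ∈ descents (w * simpleSwap i) ↔ j ∈ descents w := by
  rw [mem_descents, mem_descents, coe_mul_simpleSwap, coe_mul_simpleSwap,
    Equiv.swap_apply_of_ne_of_ne (by omega) (by omega),
    Equiv.swap_apply_of_ne_of_ne (by omega) (by omega)]

/-- For the braid relation, both sides require `w (i + 2) < w (i + 1) < w i` and then evaluate at
the same permutation. -/
theorem isNilCoxeter_descentOp : IsNilCoxeter descentOp where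
  sq i := by
    refine LinearMap.ext fun Φ => funext fun w => ?_
    rw [Module.End.mul_apply]
    by_cases h : i ∈ descents w
    · rw [descentOp_apply_of_mem h,
        descentOp_apply_of_notMem fun h' => mem_descents_mul_simpleSwap.1 h' h]
      rfl
    · rw [descentOp_apply_of_notMem h]
      rfl
  comm i j hij := by
    refine LinearMap.ext fun Φ => funext fun w => ?_
    have h1 := mem_descents_mul_of_add_two_le (Or.inl hij) w
    have h2 := mem_descents_mul_of_add_two_le (Or.inr hij) w
    simp only [Module.End.mul_apply, descentOp, LinearMap.coe_mk, AddHom.coe_mk, mul_assoc,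
      simpleSwap_comm hij]
    grind
  braid i := by
    refine LinearMap.ext fun Φ => funext fun w => ?_
    have hb := simpleSwap_braid i
    simp only [Module.End.mul_apply, descentOp, LinearMap.coe_mk, AddHom.coe_mk, mul_assoc] at hb ⊢
    rw [hb]
    have e1 : Equiv.swap i (i + 1) (i + 2) = i + 2 :=
      Equiv.swap_apply_of_ne_of_ne (by omega) (by omega)
    have e2 : Equiv.swap (i + 1) (i + 2) i = i :=
      Equiv.swap_apply_of_ne_of_ne (by omega) (by omega)
    simp only [mem_descents, coe_mul_simpleSwap, ← mul_assoc, Equiv.swap_apply_left,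
      Equiv.swap_apply_right, e1, e2, add_assoc, Nat.reduceAdd, ← ite_and]
    grind

/-- Agreement of two families on the permutations that fix all points `≥ N`. -/
def AgreeBelow (N : ℕ) (Φ Ψ : SInf → Poly) : Prop :=
  ∀ w : SInf, (∀ j, N ≤ j → (w : Equiv.Perm ℕ) j = j) → Φ w = Ψ w

theorem lt_of_mem_descents {N i : ℕ} {w : SInf} (hw : ∀ j, N ≤ j → (w : Equiv.Perm ℕ) j = j)
    (hi : i ∈ descents w) : i + 1 < N := by
  by_contra h
  rw [mem_descents, hw (i + 1) (by omega)] at hi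
  have := (w : Equiv.Perm ℕ).injective (hw _ (show N ≤ (w : Equiv.Perm ℕ) i by omega))
  omega

theorem mul_simpleSwap_fixes_ge {N i : ℕ} {w : SInf}
    (hw : ∀ j, N ≤ j → (w : Equiv.Perm ℕ) j = j) (hi : i + 1 < N) (j : ℕ) (hj : N ≤ j) :
    ((w * simpleSwap i : SInf) : Equiv.Perm ℕ) j = j := by
  rw [coe_mul_simpleSwap, Equiv.swap_apply_of_ne_of_ne (by omega) (by omega), hw j hj]

theorem one_add_smul_descentOp_apply (x : Poly) (i : ℕ) (Φ : SInf → Poly) (w : SInf) :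
    ((1 + x • descentOp i : Module.End Poly (SInf → Poly)) Φ) w = Φ w + x * descentOp i Φ w :=
  rfl

theorem AgreeBelow.one_add {N : ℕ} {Φ Ψ : SInf → Poly} (h : AgreeBelow N Φ Ψ) (x : Poly) (i : ℕ) :
    AgreeBelow N ((1 + x • descentOp i : Module.End Poly (SInf → Poly)) Φ)
      ((1 + x • descentOp i : Module.End Poly (SInf → Poly)) Ψ) := by
  intro w hw
  rw [one_add_smul_descentOp_apply, one_add_smul_descentOp_apply, h w hw]
  by_cases hi : i ∈ descents w
  · rw [descentOp_apply_of_mem hi, descentOp_apply_of_mem hi,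
      h _ (mul_simpleSwap_fixes_ge hw (lt_of_mem_descents hw hi))]
  · rw [descentOp_apply_of_notMem hi, descentOp_apply_of_notMem hi]

/-- The additional factor has index `N`, which is never a descent of a permutation fixing all points
`≥ N`. -/
theorem AgreeBelow.expProd_succ {N : ℕ} {Φ Ψ : SInf → Poly} (h : AgreeBelow N Φ Ψ) (x : Poly)
    (n : ℕ) : ∀ m, m + n = N →
      AgreeBelow N (expProd descentOp x m (n + 1) Φ) (expProd descentOp x m n Ψ) := by
  induction n with
  | zero =>
    intro m hm w hw
    have hi : m ∉ descents w := fun hi => by have := lt_of_mem_descents hw hi; omega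
    simp only [expProd, mul_one]
    rw [one_add_smul_descentOp_apply, descentOp_apply_of_notMem hi, mul_zero, add_zero]
    exact h w hw
  | succ n ih =>
    intro m hm
    rw [expProd, expProd]
    exact (ih (m + 1) (by omega)).one_add x m

open Classical in
/-- The family that is one at the identity and zero elsewhere. -/
noncomputable def unitFamily : SInf → Poly := fun w => if w = 1 then 1 else 0

/-- The family obtained by applying the truncated generating operator to the unit family. -/
noncomputable def schubertApprox (N : ℕ) (y : ℕ → Poly) : SInf → Poly :=
  schubertProd descentOp y N N unitFamily

theorem agreeBelow_schubertProd (N : ℕ) (y : ℕ → Poly) (k : ℕ) (hk : k ≤ N) :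
    AgreeBelow N (schubertProd descentOp y (N + 1) k unitFamily)
      (schubertProd descentOp y N k unitFamily) := by
  induction k with
  | zero => exact fun _ _ => rfl
  | succ k ih =>
    rw [schubertProd, schubertProd, show N + 1 - k = N - k + 1 by omega]
    exact (ih (by omega)).expProd_succ (y k) (N - k) k (by omega)

theorem agreeBelow_schubertApprox_succ (N : ℕ) (y : ℕ → Poly) :
    AgreeBelow N (schubertApprox (N + 1) y) (schubertApprox N y) := by
  intro w hw
  rw [schubertApprox, schubertProd, show N + 1 - N = 0 + 1 by omega]
  have := (agreeBelow_schubertProd N y N le_rfl).expProd_succ (y N) 0 N rfl w hw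
  exact this

theorem agreeBelow_schubertApprox {N M : ℕ} (h : N ≤ M) (y : ℕ → Poly) :
    AgreeBelow N (schubertApprox M y) (schubertApprox N y) := by
  induction M, h using Nat.le_induction with
  | base => exact fun _ _ => rfl
  | succ M hM ih =>
    intro w hw
    rw [agreeBelow_schubertApprox_succ M y w fun j hj => hw j (hM.trans hj), ih w hw]

/-! ### Substitutions and degrees in the truncated families -/

theorem map_one_add_apply (φ : Poly →ₐ[ℤ] Poly) (x : Poly) (i : ℕ) (Φ : SInf → Poly) :
    (fun w => φ (((1 + x • descentOp i : Module.End Poly (SInf → Poly)) Φ) w)) =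
      (1 + φ x • descentOp i : Module.End Poly (SInf → Poly)) fun w => φ (Φ w) := by
  funext w
  rw [one_add_smul_descentOp_apply, one_add_smul_descentOp_apply, map_add, map_mul]
  by_cases hi : i ∈ descents w
  · rw [descentOp_apply_of_mem hi, descentOp_apply_of_mem hi]
  · rw [descentOp_apply_of_notMem hi, descentOp_apply_of_notMem hi, map_zero]

theorem map_expProd_apply (φ : Poly →ₐ[ℤ] Poly) (x : Poly) (n : ℕ) (Φ : SInf → Poly) :
    ∀ m, (fun w => φ (expProd descentOp x m n Φ w)) =
      expProd descentOp (φ x) m n fun w => φ (Φ w) := by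
  induction n with
  | zero => exact fun _ => rfl
  | succ n ih =>
    intro m
    rw [expProd, expProd, Module.End.mul_apply, Module.End.mul_apply, ← ih (m + 1)]
    exact map_one_add_apply φ x m _

theorem map_schubertProd_apply (φ : Poly →ₐ[ℤ] Poly) (y : ℕ → Poly) (N k : ℕ) (Φ : SInf → Poly) :
    (fun w => φ (schubertProd descentOp y N k Φ w)) =
      schubertProd descentOp (fun j => φ (y j)) N k fun w => φ (Φ w) := by
  induction k with
  | zero => rfl
  | succ k ih =>
    rw [schubertProd, schubertProd, Module.End.mul_apply, Module.End.mul_apply, ← ih]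
    exact map_expProd_apply φ (y k) (N - k) _ k

/-- The values of `unitFamily` are `0` and `1`, so `φ` acts on the arguments only. With `swapVars`
for `φ`, this turns `schubertProd_sub` into a divided difference. -/
theorem map_schubertApprox (φ : Poly →ₐ[ℤ] Poly) (y : ℕ → Poly) (N : ℕ) (w : SInf) :
    φ (schubertApprox N y w) = schubertApprox N (fun j => φ (y j)) w := by
  have h := congrFun (map_schubertProd_apply φ y N N unitFamily) w
  have h1 : (fun w => φ (unitFamily w)) = unitFamily := by
    funext v
    rw [unitFamily, apply_ite φ, map_one, map_zero]
  rw [h1] at h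
  exact h

theorem isHomogeneous_one_add_apply {Φ : SInf → Poly}
    (h : ∀ w, (Φ w).IsHomogeneous (inversionNumber w)) (k i : ℕ) (w : SInf) :
    (((1 + (X k : Poly) • descentOp i : Module.End Poly (SInf → Poly)) Φ) w).IsHomogeneous
      (inversionNumber w) := by
  rw [one_add_smul_descentOp_apply]
  refine (h w).add ?_
  by_cases hi : i ∈ descents w
  · rw [descentOp_apply_of_mem hi, ← inversionNumber_mul_simpleSwap_of_mem hi, add_comm]
    exact (isHomogeneous_X _ _).mul (h _)
  · rw [descentOp_apply_of_notMem hi, mul_zero]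
    exact isHomogeneous_zero _ _ _

theorem isHomogeneous_expProd_apply {Φ : SInf → Poly}
    (h : ∀ w, (Φ w).IsHomogeneous (inversionNumber w)) (k n : ℕ) :
    ∀ m w, (expProd descentOp (X k : Poly) m n Φ w).IsHomogeneous (inversionNumber w) := by
  induction n with
  | zero => exact fun _ => h
  | succ n ih => exact fun m => isHomogeneous_one_add_apply (ih (m + 1)) k m

theorem isHomogeneous_schubertApprox (N : ℕ) (w : SInf) :
    (schubertApprox N X w).IsHomogeneous (inversionNumber w) := by
  suffices h : ∀ k w, (schubertProd descentOp (X : ℕ → Poly) N k unitFamily w).IsHomogeneous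
      (inversionNumber w) from h N w
  intro k
  induction k with
  | zero =>
    intro w
    change (unitFamily w).IsHomogeneous _
    by_cases hw : w = 1
    · rw [hw, unitFamily, if_pos rfl, inversionNumber_one]
      exact isHomogeneous_one _ _
    · rw [unitFamily, if_neg hw]
      exact isHomogeneous_zero _ _ _
  | succ k ih => exact isHomogeneous_expProd_apply ih k (N - k) k

/-- The Schubert polynomial of a permutation. -/
noncomputable def schubert (w : SInf) : Poly :=
  schubertApprox (exists_fixes_ge w).choose X w

theorem schubert_eq_schubertApprox {N : ℕ} {w : SInf}
    (hw : ∀ j, N ≤ j → (w : Equiv.Perm ℕ) j = j) : schubert w = schubertApprox N X w := by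
  rcases le_total N (exists_fixes_ge w).choose with h | h
  · exact agreeBelow_schubertApprox h X w hw
  · exact (agreeBelow_schubertApprox h X w (exists_fixes_ge w).choose_spec).symm

theorem divDiff_schubertApprox {N i : ℕ} (hi : i + 2 ≤ N) (w : SInf) :
    divDiff i (schubertApprox N X w) = descentOp i (schubertApprox N X) w := by
  refine divDiff_eq_of_mul_eq ?_
  have h := isNilCoxeter_descentOp.schubertProd_sub (X : ℕ → Poly) hi N hi
  have h' := congrFun (LinearMap.congr_fun h unitFamily) w
  rw [map_schubertApprox, funext fun j => swapVars_X i j]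
  exact h'

theorem isSchubertFamily_schubert : IsSchubertFamily schubert := by
  have key : ∀ w i, divDiff i (schubert w) = descentOp i schubert w := by
    intro w i
    obtain ⟨N, hN⟩ := exists_fixes_ge w
    -- The larger bound serves both `w` and `w * simpleSwap i`, and gives `i + 2 ≤ N + i + 2`.
    have hN' : ∀ j, N + i + 2 ≤ j → (w : Equiv.Perm ℕ) j = j := fun j hj => hN j (by omega)
    rw [schubert_eq_schubertApprox hN', divDiff_schubertApprox (by omega)]
    by_cases hi : i ∈ descents w
    · rw [descentOp_apply_of_mem hi, descentOp_apply_of_mem hi,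
        schubert_eq_schubertApprox (mul_simpleSwap_fixes_ge hN' (by omega))]
    · rw [descentOp_apply_of_notMem hi, descentOp_apply_of_notMem hi]
  refine ⟨fun w => ⟨_, isHomogeneous_schubertApprox _ w⟩, ?_, fun w i hi => ?_, fun w i hi => ?_⟩
  · rw [schubert_eq_schubertApprox (N := 0) fun _ _ => rfl]
    exact if_pos rfl
  · rw [key, descentOp_apply_of_mem hi]
  · rw [key, descentOp_apply_of_notMem hi]

theorem IsSchubertFamily.expansion {S : SInf → Poly} (hS : IsSchubertFamily S) (w : SInf) :
    (Red w).Finite ∧ S w = ∑ᶠ a ∈ Red w, slide a :=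
  IsDual.expansion hS isCreation_divDiff (fun i _ h => divDiff_eq_zero_of_isHomogeneous_zero i h)
    (rank := inversionNumber)
    (fun _ _ hi => by have := inversionNumber_mul_simpleSwap_of_mem hi; omega)
    (fun _ hw => descents_nonempty hw) Red_one (fun _ hw => Red_eq_biUnion hw) w

/-! ### Terminal nodes of plane binary trees -/

/-- The tree has a terminal node whose children are the leaves `p` and `p + 1`. -/
def IsTerminal (T : PlaneTree) (p : ℕ) : Prop :=
  treeCode T p ≠ 0 ∧ treeCode T (p + 1) = 0

theorem treeCode_of_numLeaves_le (T : PlaneTree) :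
    ∀ p, T.numLeaves ≤ p → treeCode T p = 0 := by
  induction T with
  | nil => exact fun _ _ => rfl
  | node v l r _ ihr =>
    intro p hp
    have := l.numLeaves_pos
    rw [BinaryTree.numLeaves] at hp
    rw [treeCode, if_neg (by omega), if_neg (by omega), ihr _ (by omega)]

theorem treeCode_last (T : PlaneTree) : ∀ p, p + 1 = T.numLeaves → treeCode T p = 0 := by
  induction T with
  | nil => exact fun _ _ => rfl
  | node v l r _ ihr =>
    intro p hp
    have := l.numLeaves_pos
    have := r.numLeaves_pos
    rw [BinaryTree.numLeaves] at hp
    rw [treeCode, if_neg (by omega), if_neg (by omega), ihr _ (by omega)]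

theorem treeCode_zero_ne_zero {T : PlaneTree} (h : T ≠ BinaryTree.nil) : treeCode T 0 ≠ 0 := by
  cases T with
  | nil => exact absurd rfl h
  | node v l r => simp [treeCode]

theorem treeTrim_of_numLeaves_le (T : PlaneTree) :
    ∀ p, T.numLeaves ≤ p → treeTrim T p = T := by
  induction T with
  | nil => exact fun _ _ => rfl
  | node v l r _ ihr =>
    intro p hp
    have := l.numLeaves_pos
    rw [BinaryTree.numLeaves] at hp
    rw [treeTrim, if_neg (show ¬ p = 0 by omega), if_neg (show ¬ p < l.numLeaves by omega),
      ihr _ (by omega), ite_self]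

theorem not_isTerminal_nil (p : ℕ) : ¬ IsTerminal BinaryTree.nil p := fun h => h.1 rfl

theorem IsTerminal.lt_numLeaves {T : PlaneTree} {p : ℕ} (h : IsTerminal T p) :
    p + 1 < T.numLeaves := by
  by_contra hp
  rcases Nat.lt_or_ge p T.numLeaves with h1 | h1
  · exact h.1 (treeCode_last T p (by omega))
  · exact h.1 (treeCode_of_numLeaves_le T p h1)

theorem one_lt_numLeaves {T : PlaneTree} (h : T ≠ BinaryTree.nil) : 1 < T.numLeaves := by
  cases T with
  | nil => exact absurd rfl h
  | node v l r =>
    have := l.numLeaves_pos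
    have := r.numLeaves_pos
    rw [BinaryTree.numLeaves]
    omega

theorem isTerminal_cherry {v : Unit} {p : ℕ} :
    IsTerminal (BinaryTree.node v BinaryTree.nil BinaryTree.nil) p ↔ p = 0 := by
  simp [IsTerminal, treeCode]

/-- The root adds only to the code at leaf `0`, already nonzero unless `l` is a leaf. In that case
`r` is nontrivial, so the code at leaf `1` is nonzero and leaf `0` is not terminal. -/
theorem isTerminal_node_left {v : Unit} {l r : PlaneTree} {p : ℕ}
    (h : ¬ (l = BinaryTree.nil ∧ r = BinaryTree.nil)) (hp : p < l.numLeaves) :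
    IsTerminal (BinaryTree.node v l r) p ↔ IsTerminal l p := by
  by_cases hl : l = BinaryTree.nil
  · subst hl
    have hr := treeCode_zero_ne_zero (T := r) fun hr => h ⟨rfl, hr⟩
    obtain rfl : p = 0 := by simpa [BinaryTree.numLeaves] using hp
    simp [IsTerminal, treeCode, BinaryTree.numLeaves, hr]
  · have h0 := treeCode_zero_ne_zero hl
    have h1 := one_lt_numLeaves hl
    rcases Nat.lt_or_ge (p + 1) l.numLeaves with h2 | h2
    · rcases Nat.eq_zero_or_pos p with rfl | h3
      · simp [IsTerminal, treeCode, hp, h0, h1]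
      · simp [IsTerminal, treeCode, hp, h2, h3.ne']
    · have h3 := treeCode_last l p (by omega)
      simp [IsTerminal, treeCode, hp, h3, show p ≠ 0 by omega]

theorem isTerminal_node_right {v : Unit} {l r : PlaneTree} {p : ℕ} (hp : l.numLeaves ≤ p) :
    IsTerminal (BinaryTree.node v l r) p ↔ IsTerminal r (p - l.numLeaves) := by
  have := l.numLeaves_pos
  rw [IsTerminal, IsTerminal, treeCode, treeCode, if_neg (by omega), if_neg (by omega),
    if_neg (by omega), if_neg (by omega), zero_add, zero_add,
    show p + 1 - l.numLeaves = p - l.numLeaves + 1 by omega]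

theorem exists_isTerminal (T : PlaneTree) (h : T ≠ BinaryTree.nil) : ∃ p, IsTerminal T p := by
  induction T with
  | nil => exact absurd rfl h
  | node v l r ihl ihr =>
    by_cases hl : l = BinaryTree.nil
    · by_cases hr : r = BinaryTree.nil
      · subst hl hr
        exact ⟨0, isTerminal_cherry.2 rfl⟩
      · obtain ⟨p, hp⟩ := ihr hr
        refine ⟨p + l.numLeaves, (isTerminal_node_right (Nat.le_add_left _ _)).2 ?_⟩
        rwa [Nat.add_sub_cancel]
    · obtain ⟨p, hp⟩ := ihl hl
      exact ⟨p, (isTerminal_node_left (fun h => hl h.1) (by have := hp.lt_numLeaves; omega)).2 hp⟩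

theorem numNodes_treeTrim (T : PlaneTree) :
    ∀ p, IsTerminal T p → (treeTrim T p).numNodes + 1 = T.numNodes := by
  induction T with
  | nil => exact fun p h => absurd h (not_isTerminal_nil p)
  | node v l r ihl ihr =>
    intro p hT
    rw [treeTrim]
    by_cases h : l = BinaryTree.nil ∧ r = BinaryTree.nil
    · obtain ⟨rfl, rfl⟩ := h
      rw [if_pos ⟨rfl, rfl⟩, if_pos (isTerminal_cherry.1 hT)]
      rfl
    · rw [if_neg h]
      by_cases hp : p < l.numLeaves
      · have := ihl p ((isTerminal_node_left h hp).1 hT)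
        rw [if_pos hp, BinaryTree.numNodes, BinaryTree.numNodes]
        omega
      · have := ihr _ ((isTerminal_node_right (not_lt.1 hp)).1 hT)
        rw [if_neg hp, BinaryTree.numNodes, BinaryTree.numNodes]
        omega

theorem numLeaves_treeTrim {T : PlaneTree} {p : ℕ} (h : IsTerminal T p) :
    (treeTrim T p).numLeaves + 1 = T.numLeaves := by
  rw [BinaryTree.numLeaves_eq_numNodes_succ, BinaryTree.numLeaves_eq_numNodes_succ,
    numNodes_treeTrim T p h]

/-! ### Tree polynomials -/

/-- The generating polynomial of the labelings of the internal nodes of a tree by natural numbers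
that are at least `m` at the root, weakly increase along left edges, strictly increase along right
edges, and are less than `b j` at a node from which one reaches leaf `j` by going down left edges.
The leaves are numbered from `s`. -/
noncomputable def treePoly (b : ℕ → ℕ) : PlaneTree → ℕ → ℕ → Poly
  | BinaryTree.nil, _, _ => 1
  | BinaryTree.node _ l r, s, m =>
      ∑ k ∈ Finset.Ico m (b s), X k * treePoly b l s k * treePoly b r (s + l.numLeaves) (k + 1)

theorem treePoly_eq_zero {b : ℕ → ℕ} {T : PlaneTree} {s m : ℕ} (hT : T ≠ BinaryTree.nil)
    (h : b s ≤ m) : treePoly b T s m = 0 := by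
  cases T with
  | nil => exact absurd rfl hT
  | node v l r => rw [treePoly, Finset.Ico_eq_empty_of_le h, Finset.sum_empty]

theorem treePoly_congr {b b' : ℕ → ℕ} (T : PlaneTree) :
    ∀ s m, (∀ j, s ≤ j → j < s + T.numLeaves → b j = b' j) →
      treePoly b T s m = treePoly b' T s m := by
  induction T with
  | nil => exact fun _ _ _ => rfl
  | node v l r ihl ihr =>
    intro s m h
    have := l.numLeaves_pos
    rw [BinaryTree.numLeaves] at h
    rw [treePoly, treePoly, h s le_rfl (by omega)]
    refine Finset.sum_congr rfl fun k _ => ?_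
    rw [ihl s k fun j h1 h2 => h j h1 (by omega),
      ihr _ (k + 1) fun j h1 h2 => h j (by omega) (by omega)]

theorem treePoly_succ (b : ℕ → ℕ) (T : PlaneTree) :
    ∀ s m, treePoly b T (s + 1) m = treePoly (fun j => b (j + 1)) T s m := by
  induction T with
  | nil => exact fun _ _ => rfl
  | node v l r ihl ihr =>
    intro s m
    rw [treePoly, treePoly]
    refine Finset.sum_congr rfl fun k _ => ?_
    rw [ihl s k, ← ihr, add_right_comm]

theorem isHomogeneous_treePoly (b : ℕ → ℕ) (T : PlaneTree) :
    ∀ s m, (treePoly b T s m).IsHomogeneous T.numNodes := by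
  induction T with
  | nil => exact fun _ _ => isHomogeneous_one _ _
  | node v l r ihl ihr =>
    intro s m
    refine IsHomogeneous.sum _ _ _ fun k _ => ?_
    rw [BinaryTree.numNodes, add_comm (_ + _) 1, ← add_assoc]
    exact ((isHomogeneous_X _ _).mul (ihl s k)).mul (ihr _ _)

/-- The effect of `zeroShift i` on lower bounds and strict upper bounds of labels. -/
def lowerBound (i m : ℕ) : ℕ := if m ≤ i then m else m - 1

/-- The term `k = i` dies and the others are renumbered by the order isomorphism from `ℕ` without
`i` to `ℕ`; `lowerBound i m` counts the `k < m` different from `i`. -/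
theorem sum_zeroShift_X_mul (i : ℕ) (g : ℕ → Poly) {m n : ℕ} :
    ∑ k ∈ Finset.Ico m n, zeroShift i (X k) * g k =
      ∑ k ∈ Finset.Ico (lowerBound i m) (lowerBound i n), X k * g (if k < i then k else k + 1) := by
  rcases le_total n m with h | h
  · rw [Finset.Ico_eq_empty_of_le h, Finset.Ico_eq_empty_of_le, Finset.sum_empty, Finset.sum_empty]
    simp only [lowerBound]
    grind
  induction n, h using Nat.le_induction with
  | base => simp
  | succ n hn ih =>
    rw [Finset.sum_Ico_succ_top hn, ih, zeroShift_X]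
    rcases lt_trichotomy n i with h | rfl | h
    · have h1 : lowerBound i (n + 1) = lowerBound i n + 1 := by simp only [lowerBound]; grind
      have h2 : lowerBound i n = n := if_pos h.le
      rw [h1, Finset.sum_Ico_succ_top (by simp only [lowerBound]; grind), h2, if_pos h, if_pos h]
    · have h1 : lowerBound n (n + 1) = lowerBound n n := by simp only [lowerBound]; grind
      simp [h1]
    · have h1 : lowerBound i (n + 1) = lowerBound i n + 1 := by simp only [lowerBound]; grind
      have h2 : lowerBound i n = n - 1 := if_neg (by omega)
      rw [h1, Finset.sum_Ico_succ_top (by simp only [lowerBound]; grind), h2, if_neg (by omega),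
        if_neg (by omega), if_neg (by omega), Nat.sub_add_cancel (by omega)]

theorem zeroShift_treePoly (i : ℕ) (b : ℕ → ℕ) (T : PlaneTree) :
    ∀ s m, zeroShift i (treePoly b T s m) =
      treePoly (fun j => lowerBound i (b j)) T s (lowerBound i m) := by
  induction T with
  | nil => exact fun _ _ => map_one _
  | node v l r ihl ihr =>
    intro s m
    rw [treePoly, treePoly, map_sum]
    simp only [map_mul, ihl, ihr, mul_assoc]
    rw [sum_zeroShift_X_mul i fun k => treePoly (fun j => lowerBound i (b j)) l s (lowerBound i k) *
      treePoly (fun j => lowerBound i (b j)) r (s + l.numLeaves) (lowerBound i (k + 1))]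
    refine Finset.sum_congr rfl fun k _ => ?_
    have h1 : lowerBound i (if k < i then k else k + 1) = k := by simp only [lowerBound]; grind
    have h2 : lowerBound i ((if k < i then k else k + 1) + 1) = k + 1 := by
      simp only [lowerBound]
      grind
    rw [h1, h2]

theorem lowerBound_succ_of_le {i j : ℕ} (h : j < i) : lowerBound i (j + 1) = j + 1 := if_pos h

theorem lowerBound_succ_of_ge {i j : ℕ} (h : i ≤ j) : lowerBound i (j + 1) = j := by
  rw [lowerBound, if_neg (by omega), Nat.add_sub_cancel]

theorem treePoly_lowerBound_of_lt {i s : ℕ} {T : PlaneTree} (h : s + T.numLeaves ≤ i) (m : ℕ) :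
    treePoly (fun j => lowerBound i (j + 1)) T s m = treePoly Nat.succ T s m :=
  treePoly_congr T s m fun _ _ h2 => lowerBound_succ_of_le (by omega)

theorem treePoly_lowerBound_of_gt {i s : ℕ} {T : PlaneTree} (h : i ≤ s + 1) (m : ℕ) :
    treePoly (fun j => lowerBound i (j + 1)) T (s + 1) m = treePoly Nat.succ T s m := by
  rw [treePoly_succ]
  exact treePoly_congr T s m fun _ _ _ => lowerBound_succ_of_ge (by omega)

-- The two bounds differ only at leaf `i`, so the difference counts labelings using the label `i` on
-- the left chain ending there. As labels weakly increase down the chain, its lowest node has label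
-- `i`. A nontrivial right subtree would need a root label above `i` and below `i + 1`, so that node
-- is terminal. Removing it yields the factor `X i`; later leaves move down by one, which restores
-- the bounds `Nat.succ`.
open Classical in
theorem treePoly_lowerBound_sub (i : ℕ) (T : PlaneTree) :
    ∀ s m p, p < T.numLeaves → s + p = i → m ≤ i →
      treePoly (fun j => lowerBound (i + 1) (j + 1)) T s m =
        treePoly (fun j => lowerBound i (j + 1)) T s m +
          if IsTerminal T p then X i * treePoly Nat.succ (treeTrim T p) s m else 0 := by
  induction T with
  | nil =>
    intro s m p _ _ _
    rw [if_neg (not_isTerminal_nil p), add_zero]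
    rfl
  | node v l r ihl ihr =>
    intro s m p hp hs hm
    have hl0 := l.numLeaves_pos
    rw [BinaryTree.numLeaves] at hp
    have hU : lowerBound (i + 1) (s + 1) = s + 1 := lowerBound_succ_of_le (by omega)
    by_cases h : l = BinaryTree.nil ∧ r = BinaryTree.nil
    · obtain ⟨rfl, rfl⟩ := h
      simp only [BinaryTree.numLeaves] at hp
      simp only [treePoly, mul_one, hU, isTerminal_cherry]
      rcases Nat.eq_zero_or_pos p with rfl | hp0
      · obtain rfl : s = i := by omega
        rw [if_pos rfl, lowerBound_succ_of_ge le_rfl, Finset.sum_Ico_succ_top hm, treeTrim,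
          if_pos ⟨rfl, rfl⟩, if_pos rfl, treePoly, mul_one]
      · rw [if_neg hp0.ne', lowerBound_succ_of_le (by omega), add_zero]
    rcases Nat.lt_or_ge p l.numLeaves with hpl | hpl
    · have hr : ∀ k, treePoly (fun j => lowerBound i (j + 1)) r (s + l.numLeaves) k =
          treePoly (fun j => lowerBound (i + 1) (j + 1)) r (s + l.numLeaves) k := fun k =>
        treePoly_congr r _ k fun j h1 _ => by
          rw [lowerBound_succ_of_ge (by omega), lowerBound_succ_of_ge (by omega)]
      -- The range for the root label may be taken up to `s` in both sums. It differs only if `s =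
      -- i`, and then the term `k = i` vanishes because a nontrivial child has no admissible label.
      have hL : treePoly (fun j => lowerBound i (j + 1)) (BinaryTree.node v l r) s m =
          ∑ k ∈ Finset.Ico m (s + 1), X k * treePoly (fun j => lowerBound i (j + 1)) l s k *
            treePoly (fun j => lowerBound (i + 1) (j + 1)) r (s + l.numLeaves) (k + 1) := by
        rw [treePoly]
        simp only [hr]
        rcases Nat.eq_zero_or_pos p with rfl | hp0
        · obtain rfl : s = i := by omega
          rw [lowerBound_succ_of_ge le_rfl, Finset.sum_Ico_succ_top hm, left_eq_add]
          by_cases hl : l = BinaryTree.nil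
          · have hr' : r ≠ BinaryTree.nil := fun hr' => h ⟨hl, hr'⟩
            rw [treePoly_eq_zero hr', mul_zero]
            subst hl
            exact (lowerBound_succ_of_ge (by simp [BinaryTree.numLeaves])).le
          · rw [treePoly_eq_zero (b := fun j => lowerBound s (j + 1)) hl
              (lowerBound_succ_of_ge le_rfl).le, mul_zero, zero_mul]
        · rw [lowerBound_succ_of_le (by omega)]
      have hUs : treePoly (fun j => lowerBound (i + 1) (j + 1)) (BinaryTree.node v l r) s m =
          ∑ k ∈ Finset.Ico m (s + 1), X k * (treePoly (fun j => lowerBound i (j + 1)) l s k +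
            if IsTerminal l p then X i * treePoly Nat.succ (treeTrim l p) s k else 0) *
            treePoly (fun j => lowerBound (i + 1) (j + 1)) r (s + l.numLeaves) (k + 1) := by
        rw [treePoly, hU]
        refine Finset.sum_congr rfl fun k hk => ?_
        rw [ihl s k p hpl hs (by have := (Finset.mem_Ico.1 hk).2; omega)]
      rw [hUs, hL]
      simp only [isTerminal_node_left h hpl, mul_add, add_mul, Finset.sum_add_distrib]
      congr 1
      split_ifs with ht
      · have h1 := numLeaves_treeTrim ht
        rw [treeTrim, if_neg h, if_pos hpl, treePoly, Finset.mul_sum]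
        refine Finset.sum_congr rfl fun k _ => ?_
        -- Trimming removes one leaf of `l`, so the leaves of `r` start one place earlier.
        rw [← h1, ← add_assoc, treePoly_lowerBound_of_gt (by omega)]
        ring
      · simp
    -- Now leaf `i` lies in `r`: all leaves of `l` precede it and keep the bounds `Nat.succ`.
    · have hl : ∀ b : ℕ → ℕ, (∀ j < i, b j = j + 1) → ∀ k, treePoly b l s k =
          treePoly Nat.succ l s k := fun b hb k =>
        treePoly_congr l s k fun j _ h2 => hb j (by omega)
      have hl1 := hl (fun j => lowerBound i (j + 1)) fun j hj => lowerBound_succ_of_le hj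
      have hl2 := hl (fun j => lowerBound (i + 1) (j + 1)) fun j hj =>
        lowerBound_succ_of_le (by omega)
      have hUs : treePoly (fun j => lowerBound (i + 1) (j + 1)) (BinaryTree.node v l r) s m =
          ∑ k ∈ Finset.Ico m (s + 1), X k * treePoly Nat.succ l s k *
            (treePoly (fun j => lowerBound i (j + 1)) r (s + l.numLeaves) (k + 1) +
            if IsTerminal r (p - l.numLeaves) then
              X i * treePoly Nat.succ (treeTrim r (p - l.numLeaves)) (s + l.numLeaves) (k + 1)
            else 0) := by
        rw [treePoly, hU]
        refine Finset.sum_congr rfl fun k hk => ?_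
        rw [hl2, ihr _ (k + 1) (p - l.numLeaves) (by omega) (by omega)
          (by have := (Finset.mem_Ico.1 hk).2; omega)]
      rw [hUs, treePoly, lowerBound_succ_of_le (show s < i by omega)]
      simp only [isTerminal_node_right hpl, mul_add, Finset.sum_add_distrib, hl1]
      congr 1
      split_ifs with ht
      · rw [treeTrim, if_neg h, if_neg (not_lt.2 hpl), treePoly, Finset.mul_sum]
        refine Finset.sum_congr rfl fun k _ => ?_
        ring
      · simp

/-! ### Indexed forests -/

namespace IndexedForest

variable (F : IndexedForest)

theorem firstLeaf_succ (j : ℕ) : F.firstLeaf (j + 1) = F.firstLeaf j + (F.tree j).numLeaves :=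
  Finset.sum_range_succ _ _

theorem firstLeaf_strictMono : StrictMono F.firstLeaf :=
  strictMono_nat_of_lt_succ fun j => by
    rw [firstLeaf_succ]
    have := (F.tree j).numLeaves_pos
    omega

theorem exists_firstLeaf_le (i : ℕ) : ∃ j p, p < (F.tree j).numLeaves ∧ F.firstLeaf j + p = i := by
  induction i with
  | zero => exact ⟨0, 0, (F.tree 0).numLeaves_pos, rfl⟩
  | succ i ih =>
    obtain ⟨j, p, hp, h⟩ := ih
    rcases Nat.lt_or_ge (p + 1) (F.tree j).numLeaves with h1 | h1
    · exact ⟨j, p + 1, h1, by omega⟩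
    · exact ⟨j + 1, 0, (F.tree (j + 1)).numLeaves_pos, by rw [firstLeaf_succ]; omega⟩

variable {F}

theorem firstLeaf_add_le_of_lt {j k : ℕ} (h : k < j) :
    F.firstLeaf k + (F.tree k).numLeaves ≤ F.firstLeaf j := by
  rw [← firstLeaf_succ]
  exact F.firstLeaf_strictMono.monotone h

theorem code_firstLeaf_add {j p : ℕ} (hp : p < (F.tree j).numLeaves) :
    F.code (F.firstLeaf j + p) = treeCode (F.tree j) p := by
  rw [code, Finset.sum_eq_single j]
  · rw [if_pos (Nat.le_add_right _ _), Nat.add_sub_cancel_left]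
  · intro k _ hk
    rcases lt_or_gt_of_ne hk with hk | hk
    · have := firstLeaf_add_le_of_lt (F := F) hk
      rw [if_pos (by omega), treeCode_of_numLeaves_le _ _ (by omega)]
    · have := firstLeaf_add_le_of_lt (F := F) hk
      rw [if_neg (by omega)]
  · intro h
    have := F.firstLeaf_strictMono.le_apply (x := j)
    simp only [Finset.mem_range] at h
    omega

/-- At the last leaf of a tree the code vanishes, so the code at the first leaf of the next tree is
irrelevant. -/
theorem mem_leftTerminal_iff {j p : ℕ} (hp : p < (F.tree j).numLeaves) :
    F.firstLeaf j + p ∈ F.leftTerminal ↔ IsTerminal (F.tree j) p := by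
  change F.code (F.firstLeaf j + p) ≠ 0 ∧ F.code (F.firstLeaf j + p + 1) = 0 ↔ _
  rw [code_firstLeaf_add hp]
  rcases Nat.lt_or_ge (p + 1) (F.tree j).numLeaves with h | h
  · rw [add_assoc, code_firstLeaf_add h]
    rfl
  · have := treeCode_last (F.tree j) p (by omega)
    simp [IsTerminal, this]

theorem trim_tree_self (j p : ℕ) :
    (F.trim (F.firstLeaf j + p)).tree j = treeTrim (F.tree j) p := by
  change (if _ then _ else _) = _
  rw [if_pos (Nat.le_add_right _ _), Nat.add_sub_cancel_left]

theorem trim_tree_of_ne {j p k : ℕ} (hp : p < (F.tree j).numLeaves) (hk : k ≠ j) :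
    (F.trim (F.firstLeaf j + p)).tree k = F.tree k := by
  change (if _ then _ else _) = _
  rcases lt_or_gt_of_ne hk with hk | hk
  · have := firstLeaf_add_le_of_lt (F := F) hk
    rw [if_pos (by omega), treeTrim_of_numLeaves_le _ _ (by omega)]
  · have := firstLeaf_add_le_of_lt (F := F) hk
    rw [if_neg (by omega)]

theorem firstLeaf_trim_of_le {j p k : ℕ} (hp : p < (F.tree j).numLeaves) (hk : k ≤ j) :
    (F.trim (F.firstLeaf j + p)).firstLeaf k = F.firstLeaf k := by
  induction k with
  | zero => rfl
  | succ k ih => rw [firstLeaf_succ, firstLeaf_succ, ih (by omega), trim_tree_of_ne hp (by omega)]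

theorem firstLeaf_trim_of_lt {j p k : ℕ} (hT : IsTerminal (F.tree j) p) (hk : j < k) :
    (F.trim (F.firstLeaf j + p)).firstLeaf k + 1 = F.firstLeaf k := by
  have hp : p < (F.tree j).numLeaves := by have := hT.lt_numLeaves; omega
  induction k, hk using Nat.le_induction with
  | base =>
    have := numLeaves_treeTrim hT
    rw [firstLeaf_succ, firstLeaf_succ, firstLeaf_trim_of_le hp le_rfl, trim_tree_self]
    omega
  | succ k hk ih =>
    rw [firstLeaf_succ, firstLeaf_succ, trim_tree_of_ne hp (by omega)]
    omega

theorem ext_tree {F G : IndexedForest} (h : ∀ j, F.tree j = G.tree j) : F = G := by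
  obtain ⟨t, ht⟩ := F
  obtain ⟨u, hu⟩ := G
  obtain rfl : t = u := funext h
  rfl

theorem leftTerminal_nonempty (hF : F ≠ emptyForest) : F.leftTerminal.Nonempty := by
  obtain ⟨j, hj⟩ : ∃ j, F.tree j ≠ BinaryTree.nil := by
    by_contra! h
    exact hF (ext_tree h)
  obtain ⟨p, hp⟩ := exists_isTerminal _ hj
  exact ⟨_, (mem_leftTerminal_iff (by have := hp.lt_numLeaves; omega)).2 hp⟩

theorem exists_isTerminal_of_mem {i : ℕ} (hi : i ∈ F.leftTerminal) :
    ∃ j p, IsTerminal (F.tree j) p ∧ F.firstLeaf j + p = i := by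
  obtain ⟨j, p, hp, rfl⟩ := F.exists_firstLeaf_le i
  exact ⟨j, p, (mem_leftTerminal_iff hp).1 hi, rfl⟩

theorem leftTerminal_emptyForest : emptyForest.leftTerminal = ∅ := by
  refine Set.eq_empty_of_forall_notMem fun i hi => ?_
  obtain ⟨j, p, h, _⟩ := exists_isTerminal_of_mem hi
  exact not_isTerminal_nil p h

variable (F) in
theorem exists_tree_eq_nil_of_ge : ∃ N, ∀ j, N ≤ j → F.tree j = BinaryTree.nil := by
  obtain ⟨N, hN⟩ := F.finite_support.bddAbove
  refine ⟨N + 1, fun j hj => ?_⟩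
  by_contra h
  have : j ≤ N := hN h
  omega

/-- The number of internal nodes of a forest. -/
noncomputable def numNodes (F : IndexedForest) : ℕ := ∑ᶠ j, (F.tree j).numNodes

theorem numNodes_eq_sum {N : ℕ} (hN : ∀ j, N ≤ j → F.tree j = BinaryTree.nil) :
    F.numNodes = ∑ j ∈ Finset.range N, (F.tree j).numNodes := by
  refine finsum_eq_sum_of_support_subset _ fun j hj => ?_
  by_contra h
  simp only [Finset.coe_range, Set.mem_Iio, not_lt] at h
  exact hj (by simp only [hN j h]; rfl)

theorem trim_tree_eq_nil (i : ℕ) {j : ℕ} (hj : F.tree j = BinaryTree.nil) :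
    (F.trim i).tree j = BinaryTree.nil := by
  change (if _ then _ else _) = _
  rw [hj, treeTrim, ite_self]

theorem numNodes_trim_lt {i : ℕ} (hi : i ∈ F.leftTerminal) :
    (F.trim i).numNodes < F.numNodes := by
  obtain ⟨j, p, hT, rfl⟩ := exists_isTerminal_of_mem hi
  have hp : p < (F.tree j).numLeaves := by have := hT.lt_numLeaves; omega
  obtain ⟨N, hN⟩ := F.exists_tree_eq_nil_of_ge
  have hj : j < N := by
    by_contra h
    rw [hN j (not_lt.1 h)] at hT
    exact not_isTerminal_nil p hT
  have h1 := numNodes_treeTrim _ p hT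
  rw [numNodes_eq_sum hN, numNodes_eq_sum fun k hk => trim_tree_eq_nil _ (hN k hk)]
  refine Finset.sum_lt_sum (fun k _ => ?_) ⟨j, Finset.mem_range.2 hj, ?_⟩
  · by_cases hk : k = j
    · subst hk
      rw [trim_tree_self]
      omega
    · rw [trim_tree_of_ne hp hk]
  · rw [trim_tree_self]
    omega

end IndexedForest

/-! ### Trimming sequences -/

theorem Trim_emptyForest : Trim emptyForest = {[]} := by
  ext l
  constructor
  · intro h
    cases h with
    | nil => rfl
    | snoc l i _ hi _ => simp [IndexedForest.leftTerminal_emptyForest] at hi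
  · rintro rfl
    exact IsTrimming.nil

theorem Trim_eq_biUnion {F : IndexedForest} (hF : F ≠ emptyForest) :
    Trim F = ⋃ i ∈ F.leftTerminal, (· ++ [i]) '' Trim (F.trim i) := by
  ext l
  simp only [Set.mem_iUnion, Set.mem_image, exists_prop]
  constructor
  · intro h
    cases h with
    | nil => exact absurd rfl hF
    | snoc l i _ hi hl => exact ⟨i, hi, l, hl, rfl⟩
  · rintro ⟨i, hi, l, hl, rfl⟩
    exact IsTrimming.snoc l i F hi hl

/-! ### Existence of forest polynomials -/

/-- The forest polynomial of an indexed forest, as the product of its tree polynomials. -/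
noncomputable def forestPoly (F : IndexedForest) : Poly :=
  ∏ᶠ j, treePoly Nat.succ (F.tree j) (F.firstLeaf j) 0

theorem forestPoly_eq_prod {F : IndexedForest} {N : ℕ}
    (hN : ∀ j, N ≤ j → F.tree j = BinaryTree.nil) :
    forestPoly F = ∏ j ∈ Finset.range N, treePoly Nat.succ (F.tree j) (F.firstLeaf j) 0 := by
  refine finprod_eq_prod_of_mulSupport_subset _ fun j hj => ?_
  by_contra h
  simp only [Finset.coe_range, Set.mem_Iio, not_lt] at h
  exact hj (by simp only [hN j h]; rfl)

theorem isHomogeneous_forestPoly (F : IndexedForest) :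
    (forestPoly F).IsHomogeneous F.numNodes := by
  obtain ⟨N, hN⟩ := F.exists_tree_eq_nil_of_ge
  rw [forestPoly_eq_prod hN, IndexedForest.numNodes_eq_sum hN]
  exact IsHomogeneous.prod _ _ _ fun j _ => isHomogeneous_treePoly _ _ _ _

-- Only the tree containing leaf `i` distinguishes `zeroShift (i + 1)` from `zeroShift i`. The other
-- factors are common and become the factors of the trimmed forest: unchanged on the left, moved
-- down by one leaf on the right.
open Classical in
theorem qsymDivDiff_forestPoly (F : IndexedForest) (i : ℕ) :
    qsymDivDiff i (forestPoly F) = if i ∈ F.leftTerminal then forestPoly (F.trim i) else 0 := by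
  refine qsymDivDiff_eq_of_mul_eq ?_
  obtain ⟨j, p, hp, rfl⟩ := F.exists_firstLeaf_le i
  obtain ⟨N₀, hN₀⟩ := F.exists_tree_eq_nil_of_ge
  obtain ⟨N, hN, hj⟩ : ∃ N, (∀ k, N ≤ k → F.tree k = BinaryTree.nil) ∧ j < N :=
    ⟨N₀ + j + 1, fun k hk => hN₀ k (by omega), by omega⟩
  have hj' : j ∈ Finset.range N := Finset.mem_range.2 hj
  set i := F.firstLeaf j + p with hi
  have hcomm : ∀ k ≠ j,
      treePoly (fun q => lowerBound (i + 1) (q + 1)) (F.tree k) (F.firstLeaf k) 0 =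
        treePoly (fun q => lowerBound i (q + 1)) (F.tree k) (F.firstLeaf k) 0 := by
    intro k hk
    refine treePoly_congr _ _ _ fun q h1 h2 => ?_
    rcases lt_or_gt_of_ne hk with hk | hk
    · have := IndexedForest.firstLeaf_add_le_of_lt (F := F) hk
      rw [lowerBound_succ_of_le (by omega), lowerBound_succ_of_le (by omega)]
    · have := IndexedForest.firstLeaf_add_le_of_lt (F := F) hk
      rw [lowerBound_succ_of_ge (by omega), lowerBound_succ_of_ge (by omega)]
  have hz : ∀ i', zeroShift i' (forestPoly F) = ∏ k ∈ Finset.range N,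
      treePoly (fun q => lowerBound i' (q + 1)) (F.tree k) (F.firstLeaf k) 0 := by
    intro i'
    rw [forestPoly_eq_prod hN, map_prod]
    exact Finset.prod_congr rfl fun k _ => zeroShift_treePoly _ _ _ _ _
  rw [hz, hz, ← Finset.mul_prod_erase _ _ hj', ← Finset.mul_prod_erase _ _ hj',
    Finset.prod_congr rfl fun k hk => hcomm k (Finset.ne_of_mem_erase hk), ← sub_mul,
    treePoly_lowerBound_sub i _ _ 0 p hp hi.symm (Nat.zero_le _), add_sub_cancel_left,
    IndexedForest.mem_leftTerminal_iff hp]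
  split_ifs with hT
  · rw [forestPoly_eq_prod fun k hk => IndexedForest.trim_tree_eq_nil _ (hN k hk),
      ← Finset.mul_prod_erase _ _ hj', IndexedForest.trim_tree_self,
      IndexedForest.firstLeaf_trim_of_le hp le_rfl, mul_assoc]
    congr 2
    refine Finset.prod_congr rfl fun k hk => ?_
    have hk := Finset.ne_of_mem_erase hk
    rw [IndexedForest.trim_tree_of_ne hp hk]
    rcases lt_or_gt_of_ne hk with hk | hk
    · have := IndexedForest.firstLeaf_add_le_of_lt (F := F) hk
      rw [IndexedForest.firstLeaf_trim_of_le hp hk.le, treePoly_lowerBound_of_lt (by omega)]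
    · have := IndexedForest.firstLeaf_add_le_of_lt (F := F) hk
      have h1 := IndexedForest.firstLeaf_trim_of_lt hT hk
      rw [← h1, treePoly_lowerBound_of_gt (by omega)]
  · simp

theorem isForestFamily_forestPoly : IsForestFamily forestPoly where
  homogeneous F := ⟨_, isHomogeneous_forestPoly F⟩
  map_one := by
    rw [forestPoly_eq_prod (N := 0) fun _ _ => rfl]
    rfl
  apply_of_mem F i hi := by rw [qsymDivDiff_forestPoly, if_pos hi]
  apply_of_notMem F i hi := by rw [qsymDivDiff_forestPoly, if_neg hi]

theorem IsForestFamily.expansion {P : IndexedForest → Poly} (hP : IsForestFamily P)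
    (F : IndexedForest) : (Trim F).Finite ∧ P F = ∑ᶠ a ∈ Trim F, slide a :=
  IsDual.expansion hP isCreation_qsymDivDiff
    (fun i _ h => qsymDivDiff_eq_zero_of_isHomogeneous_zero i h)
    (rank := IndexedForest.numNodes) (fun _ _ hi => IndexedForest.numNodes_trim_lt hi)
    (fun _ hF => IndexedForest.leftTerminal_nonempty hF) Trim_emptyForest
    (fun _ hF => Trim_eq_biUnion hF) F

end SlideExpansion

theorem proposition5p7 :
    -- The slide creators are creation operators for both kinds of divided differences.
    SlideExpansion.IsCreation SlideExpansion.slideCreator SlideExpansion.divDiff ∧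
    SlideExpansion.IsCreation SlideExpansion.slideCreator SlideExpansion.qsymDivDiff ∧
    -- The Schubert polynomials exist and are unique, and have the slide expansion over reduced
    -- words.
    (∃! S : SlideExpansion.SInf → SlideExpansion.Poly, SlideExpansion.IsSchubertFamily S) ∧
    (∀ S : SlideExpansion.SInf → SlideExpansion.Poly, SlideExpansion.IsSchubertFamily S →
      ∀ w : SlideExpansion.SInf, (SlideExpansion.Red w).Finite ∧
        S w = ∑ᶠ a ∈ SlideExpansion.Red w, SlideExpansion.slide a) ∧
    -- The forest polynomials exist and are unique, and have the slide expansion over trimming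
    -- sequences.
    (∃! P : SlideExpansion.IndexedForest → SlideExpansion.Poly,
      SlideExpansion.IsForestFamily P) ∧
    (∀ P : SlideExpansion.IndexedForest → SlideExpansion.Poly, SlideExpansion.IsForestFamily P →
      ∀ F : SlideExpansion.IndexedForest, (SlideExpansion.Trim F).Finite ∧
        P F = ∑ᶠ a ∈ SlideExpansion.Trim F, SlideExpansion.slide a) := by
  refine ⟨SlideExpansion.isCreation_divDiff, SlideExpansion.isCreation_qsymDivDiff,
    ⟨SlideExpansion.schubert, SlideExpansion.isSchubertFamily_schubert, fun S hS => ?_⟩,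
    fun S hS => hS.expansion,
    ⟨SlideExpansion.forestPoly, SlideExpansion.isForestFamily_forestPoly, fun P hP => ?_⟩,
    fun P hP => hP.expansion⟩
  -- Uniqueness: the expansion determines each member of the family.
  · funext w
    rw [(hS.expansion w).2, (SlideExpansion.isSchubertFamily_schubert.expansion w).2]
  · funext F
    rw [(hP.expansion F).2, (SlideExpansion.isForestFamily_forestPoly.expansion F).2]
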